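/- **Setting.** Let $n\ge 0$, let $X_n$ be the set of transpositions in $S_n$, let $C_2=\{1,z\}$ and $R=\mathbb C C_2=\mathbb C[z]/(z^2-1)$. For a commutative ring $K$ and a function $q\colon S_n\times X_n\to K^\times$ with $q(\rho\sigma,\tau)=q(\rho,\sigma\tau\sigma^{-1})q(\sigma,\tau)$, let $KX_n$ be the free $K$-module with basis $e_\tau$, $\tau\in X_n$, with braiding $\Psi(e_\tau\otimes e_\upsilon)=q(\tau,\upsilon)\,e_{\tau\upsilon\tau^{-1}}\otimes e_\tau$. Put $$[m]_\Psi=\mathrm{id}+\Psi_{m-1,m}+\Psi_{m-1,m}\Psi_{m-2,m-1}+\dots+\Psi_{m-1,m}\cdots\Psi_{1,2},\qquad [m]!_\Psi=([1]_\Psi\otimes \mathrm{id})([2]_\Psi\otimes \mathrm{id})\cdots[m]_\Psi$$ on $(KX_n)^{\otimes m}$, and let $\mathcal B(KX_n,q)=T(KX_n)/\bigoplus_m\ker[m]!_\Psi$, graded by $S_n$ with $e_\tau$ in degree $\tau$. For $K=\mathbb C$ write $\mathcal B(X_n,q)$. For $u\in K^\times$ with $u^2=1$ let $q_u$ be the function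 as above with, for $\sigma\in X_n$ and $i<j$, $$q_u(\sigma,(i\,j))=\begin{cases}u,&\sigma(i)<\sigma(j),\\-1,&\sigma(i)>\sigma(j);\end{cases}$$ this gives $q_1,q_{-1}$ over $\mathbb C$ and $q_z$ over $R$. For a normalised $2$-cocycle $\mu\in Z^2(S_n,R^\times)$ (trivial action), the cocycle extension $\widetilde A_\mu$ of an $S_n$-graded $\mathbb C$-algebra $A$ is $R\otimes_{\mathbb C}A$ with the product $a\star b=\mu(g,h)ab$ for $a\in R\otimes A_g$, $b\in R\otimes A_h$. Let $[1,z]\in H^2(S_n,C_2)$ be the class of the normalised cocycles $\mu$ with $\mu(s_i,s_i)=1$ for all $i$, and $\mu(s_k,s_l)=1$, $\mu(s_l,s_k)=z$ for all $k<l$, where $s_i=(i\ i{+}1)$. For an $R$-algebra $\widetilde A$ and $\zeta=\pm1$ let $\widetilde A|_{z=\zeta}=\widetilde A/(z-\zeta)\widetilde A$. **Theorem.** The $S_n$-degree makes $\mathcal B(X_n,q_1)$, $\mathcal B(X_n,q_{-1})$ and $\mathcal B(RX_n,q_z)$ into $S_n$-graded algebras. 1. For every cocycle $\mu\colon S_n\times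 S_n\to C_2$ representing $[1,z]$, the algebra $\mathcal B(RX_n,q_z)$ is isomorphic, as an $S_n$-graded $R$-algebra, to the cocycle extension of $\mathcal B(X_n,q_1)$ by $\mu$, and to the cocycle extension of $\mathcal B(X_n,q_{-1})$ by $\mu\cdot(\mu|_{z=-1})\in Z^2(S_n,R^\times)$, through isomorphisms that send each $e_\tau$ to $c_\tau\otimes e_\tau$ for some units $c_\tau\in R^\times$. Moreover, there is a representative $\mu$ of $[1,z]$ for which both isomorphisms can be chosen with $e_\tau\mapsto 1\otimes e_\tau$ for all $\tau$. 2. $\mathcal B(RX_n,q_z)$ is a free $R$-module, and $e_\tau\mapsto e_\tau$ induces isomorphisms of $\mathbb C$-algebras $$\mathcal B(RX_n,q_z)|_{z=1}\cong\mathcal B(X_n,q_1),\qquad \mathcal B(RX_n,q_z)|_{z=-1}\cong\mathcal B(X_n,q_{-1}).$$ Hence $$\mathcal B(RX_n,q_z)\cong\tfrac{1+z}2\,\mathcal B(X_n,q_1)\oplus\tfrac{1-z}2\,\mathcal B(X_n,q_{-1})$$ as a direct sum of two-sided ideals. That is, the two-sided ideals $I_\pm$ of $\mathcal B(RX_n,q_z)$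 generated by $\frac{1\pm z}2$ are complementary, and there is an isomorphism of $\mathbb C$-algebras $\mathcal B(RX_n,q_z)\to\mathcal B(X_n,q_1)\times\mathcal B(X_n,q_{-1})$ with $e_\tau\mapsto(e_\tau,e_\tau)$ and $z\mapsto(1,-1)$ that maps $I_+$ onto $\mathcal B(X_n,q_1)\times0$ and $I_-$ onto $0\times\mathcal B(X_n,q_{-1})$. -/

import Mathlib

open scoped TensorProduct

noncomputable section

namespace SuperNichols

/-! ## Braided factorials and the algebra `T(V) / ker Wor(Ψ)` -/

section Braided

variable {R V : Type*} [CommRing R] [AddCommGroup V] [Module R V]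

/-- The canonical isomorphism `V^{⊗n} ⊗ V ≃ V^{⊗(n+1)}`. -/
def snoc (R V : Type*) [CommRing R] [AddCommGroup V] [Module R V] (n : ℕ) :
    (⨂[R]^n V) ⊗[R] V ≃ₗ[R] ⨂[R]^(n + 1) V :=
  (TensorProduct.congr (LinearEquiv.refl R _)
    (PiTensorProduct.subsingletonEquiv (R := R) (s := fun _ : Fin 1 => V) 0).symm).trans
    TensorPower.mulEquiv

/-- `f ⊗ id_V`, as an endomorphism of `V^{⊗(n+1)}`, for an endomorphism `f` of `V^{⊗n}`. -/
def tensorId {n : ℕ} (f : Module.End R (⨂[R]^n V)) : Module.End R (⨂[R]^(n + 1) V) :=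
  (snoc R V n).toLinearMap ∘ₗ f.rTensor V ∘ₗ (snoc R V n).symm.toLinearMap

/-- `Ψ` applied to the last two tensor factors of `V^{⊗(n+2)}`, i.e. `Ψ_{n+1,n+2}` in
leg notation. -/
def lastLeg (Ψ : Module.End R (V ⊗[R] V)) (n : ℕ) : Module.End R (⨂[R]^(n + 2) V) :=
  let e : (⨂[R]^n V) ⊗[R] (V ⊗[R] V) ≃ₗ[R] ⨂[R]^(n + 2) V :=
    ((TensorProduct.assoc R (⨂[R]^n V) V V).symm.trans
      (TensorProduct.congr (snoc R V n) (LinearEquiv.refl R V))).trans (snoc R V (n + 1))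
  e.toLinearMap ∘ₗ Ψ.lTensor (⨂[R]^n V) ∘ₗ e.symm.toLinearMap

/-- `braidedInt Ψ n` is the braided integer
`[n+1]_Ψ = id + Ψ_{n,n+1} + Ψ_{n,n+1} Ψ_{n-1,n} + ⋯ + Ψ_{n,n+1} ⋯ Ψ_{1,2}`
on `V^{⊗(n+1)}`, through `[n+2]_Ψ = id + Ψ_{n+1,n+2} ([n+1]_Ψ ⊗ id)`. -/
def braidedInt (Ψ : Module.End R (V ⊗[R] V)) : (n : ℕ) → Module.End R (⨂[R]^(n + 1) V)
  | 0 => LinearMap.id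
  | n + 1 => LinearMap.id + lastLeg Ψ n ∘ₗ tensorId (braidedInt Ψ n)

/-- The braided factorial (Woronowicz symmetriser of degree `n`)
`[n]!_Ψ = ([1]_Ψ ⊗ id) ([2]_Ψ ⊗ id) ⋯ [n]_Ψ` on `V^{⊗n}`. -/
def braidedFactorial (Ψ : Module.End R (V ⊗[R] V)) : (n : ℕ) → Module.End R (⨂[R]^n V)
  | 0 => LinearMap.id
  | n + 1 => tensorId (braidedFactorial Ψ n) ∘ₗ braidedInt Ψ n

/-- The algebra `𝓑(V, Ψ) = T(V) / ⨁ₙ ker [n]!_Ψ`. The relations imposed are `i_n(t) = 0` for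
`t ∈ ker [n]!_Ψ`, where `i_n : V^{⊗n} → T(V)` is the canonical injection. (For a braiding `Ψ`
the sum of these kernels is a two-sided ideal of `T(V)`.) -/
abbrev NicholsAlgebra (Ψ : Module.End R (V ⊗[R] V)) : Type _ :=
  RingQuot (fun a b : TensorAlgebra R V =>
    ∃ (n : ℕ) (t : ⨂[R]^n V), t ∈ LinearMap.ker (braidedFactorial Ψ n) ∧
      a = TensorPower.toTensorAlgebra t ∧ b = 0)

/-- The canonical map `V → 𝓑(V, Ψ)`. -/
def NicholsAlgebra.ι (Ψ : Module.End R (V ⊗[R] V)) : V →ₗ[R] NicholsAlgebra Ψ :=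
  (RingQuot.mkAlgHom R _).toLinearMap ∘ₗ TensorAlgebra.ι R

end Braided

/-! ## Normalised `2`-cocycles with trivial action -/

/-- Normalised `2`-cocycles on `G` with values in the abelian group `Γ` (trivial action). -/
@[ext]
structure TwoCocycle (G Γ : Type*) [Group G] [CommGroup Γ] where
  toFun : G → G → Γ
  cocycle : ∀ g h k, toFun g h * toFun (g * h) k = toFun g (h * k) * toFun h k
  one_left : ∀ g, toFun 1 g = 1
  one_right : ∀ g, toFun g 1 = 1

namespace TwoCocycle

variable {G Γ Δ : Type*} [Group G] [CommGroup Γ] [CommGroup Δ]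

instance : CoeFun (TwoCocycle G Γ) (fun _ => G → G → Γ) := ⟨toFun⟩

/-- The pointwise product of cocycles. -/
instance : Mul (TwoCocycle G Γ) where
  mul μ ν :=
    { toFun := fun g h => μ g h * ν g h
      cocycle := fun g h k => by
        rw [mul_mul_mul_comm, μ.cocycle, ν.cocycle, mul_mul_mul_comm]
      one_left := fun g => by rw [μ.one_left, ν.one_left, mul_one]
      one_right := fun g => by rw [μ.one_right, ν.one_right, mul_one] }

/-- Change of coefficients along a group homomorphism. -/
def map (f : Γ →* Δ) (μ : TwoCocycle G Γ) : TwoCocycle G Δ where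
  toFun g h := f (μ g h)
  cocycle g h k := by rw [← map_mul, μ.cocycle, map_mul]
  one_left g := by rw [μ.one_left, map_one]
  one_right g := by rw [μ.one_right, map_one]

/-- `μ` and `ν` differ by the coboundary `dφ(g,h) = φ(h) φ(gh)⁻¹ φ(g)` of a function `φ` with
`φ(1) = 1`. -/
def Cohomologous (μ ν : TwoCocycle G Γ) : Prop :=
  ∃ φ : G → Γ, φ 1 = 1 ∧ ∀ g h, ν g h = μ g h * (φ h * (φ (g * h))⁻¹ * φ g)

end TwoCocycle

/-! ## Cocycle twists and cocycle extensions of `G`-graded algebras -/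

section Twist

variable {G : Type*} [Group G] [Fintype G] [DecidableEq G]
variable {R A : Type*} [CommRing R] [Ring A] [Algebra R A]

/-- The underlying module of the twist `A_μ` of a `G`-graded `R`-algebra `A`; it is `A`. -/
def CocycleTwist (_𝒜 : Additive G → Submodule R A) (_μ : TwoCocycle G Rˣ) : Type _ := A

variable (𝒜 : Additive G → Submodule R A) (μ : TwoCocycle G Rˣ)

namespace CocycleTwist

instance : AddCommGroup (CocycleTwist 𝒜 μ) := inferInstanceAs (AddCommGroup A)
instance : Module R (CocycleTwist 𝒜 μ) := inferInstanceAs (Module R A)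

/-- The identity map from `A` to the twist `A_μ`. -/
def of : A ≃ₗ[R] CocycleTwist 𝒜 μ := LinearEquiv.refl R A

variable [GradedAlgebra 𝒜]

/-- The twisted product `a ⋆ b = ∑_{g,h} μ(g,h) a_g b_h`. -/
def mulAux (a b : A) : A :=
  ∑ g : G, ∑ h : G, (μ g h : R) •
    (GradedAlgebra.proj 𝒜 (Additive.ofMul g) a * GradedAlgebra.proj 𝒜 (Additive.ofMul h) b)

theorem mulAux_add_left (a a' b : A) :
    mulAux 𝒜 μ (a + a') b = mulAux 𝒜 μ a b + mulAux 𝒜 μ a' b := by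
  simp [mulAux, add_mul, Finset.sum_add_distrib]

theorem mulAux_add_right (a b b' : A) :
    mulAux 𝒜 μ a (b + b') = mulAux 𝒜 μ a b + mulAux 𝒜 μ a b' := by
  simp [mulAux, mul_add, Finset.sum_add_distrib]

theorem mulAux_zero_left (b : A) : mulAux 𝒜 μ 0 b = 0 := by simp [mulAux]

theorem mulAux_zero_right (a : A) : mulAux 𝒜 μ a 0 = 0 := by simp [mulAux]

theorem mulAux_smul_left (r : R) (a b : A) : mulAux 𝒜 μ (r • a) b = r • mulAux 𝒜 μ a b := by
  simp only [mulAux, map_smul, Finset.smul_sum, smul_mul_assoc]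
  exact Finset.sum_congr rfl fun g _ => Finset.sum_congr rfl fun h _ => smul_comm _ _ _

theorem mulAux_smul_right (r : R) (a b : A) : mulAux 𝒜 μ a (r • b) = r • mulAux 𝒜 μ a b := by
  simp only [mulAux, map_smul, Finset.smul_sum, mul_smul_comm]
  exact Finset.sum_congr rfl fun g _ => Finset.sum_congr rfl fun h _ => smul_comm _ _ _

/-- `a ⋆ b = μ(g,h) a b` for `a ∈ A_g`, `b ∈ A_h`. -/
theorem mulAux_of_mem {g h : G} {a b : A} (ha : a ∈ 𝒜 (Additive.ofMul g))
    (hb : b ∈ 𝒜 (Additive.ofMul h)) : mulAux 𝒜 μ a b = (μ g h : R) • (a * b) := by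
  rw [mulAux, Finset.sum_eq_single g, Finset.sum_eq_single h]
  · rw [GradedAlgebra.proj_apply, GradedAlgebra.proj_apply,
      DirectSum.decompose_of_mem_same 𝒜 ha, DirectSum.decompose_of_mem_same 𝒜 hb]
  · intro k _ hk
    rw [GradedAlgebra.proj_apply 𝒜 _ b,
      DirectSum.decompose_of_mem_ne 𝒜 hb (fun e => hk (Additive.ofMul.injective e).symm),
      mul_zero, smul_zero]
  · simp
  · intro k _ hk
    refine Finset.sum_eq_zero fun h' _ => ?_
    rw [GradedAlgebra.proj_apply 𝒜 _ a,
      DirectSum.decompose_of_mem_ne 𝒜 ha (fun e => hk (Additive.ofMul.injective e).symm),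
      zero_mul, smul_zero]
  · simp

theorem mulAux_one_left (a : A) : mulAux 𝒜 μ 1 a = a := by
  induction a using DirectSum.Decomposition.inductionOn 𝒜 with
  | zero => exact mulAux_zero_right 𝒜 μ 1
  | homogeneous a =>
    rename_i i
    rw [mulAux_of_mem 𝒜 μ (g := 1) (h := i.toMul) (SetLike.GradedOne.one_mem (A := 𝒜)) a.2, μ.one_left]
    simp
  | add a b ha hb => rw [mulAux_add_right, ha, hb]

theorem mulAux_one_right (a : A) : mulAux 𝒜 μ a 1 = a := by
  induction a using DirectSum.Decomposition.inductionOn 𝒜 with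
  | zero => exact mulAux_zero_left 𝒜 μ 1
  | homogeneous a =>
    rename_i i
    rw [mulAux_of_mem 𝒜 μ (g := i.toMul) (h := 1) a.2 (SetLike.GradedOne.one_mem (A := 𝒜)), μ.one_right]
    simp
  | add a b ha hb => rw [mulAux_add_left, ha, hb]

theorem mulAux_assoc (a b c : A) :
    mulAux 𝒜 μ (mulAux 𝒜 μ a b) c = mulAux 𝒜 μ a (mulAux 𝒜 μ b c) := by
  induction a using DirectSum.Decomposition.inductionOn 𝒜 with
  | zero => simp only [mulAux_zero_left]
  | add a a' ha ha' => simp only [mulAux_add_left, ha, ha']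
  | homogeneous a =>
    rename_i i
    induction b using DirectSum.Decomposition.inductionOn 𝒜 with
    | zero => simp only [mulAux_zero_left, mulAux_zero_right]
    | add b b' hb hb' => simp only [mulAux_add_left, mulAux_add_right, hb, hb']
    | homogeneous b =>
      rename_i j
      induction c using DirectSum.Decomposition.inductionOn 𝒜 with
      | zero => simp only [mulAux_zero_right]
      | add c c' hc hc' => simp only [mulAux_add_right, hc, hc']
      | homogeneous c =>
        rename_i k
        have hab : (a : A) * b ∈ 𝒜 (Additive.ofMul (i.toMul * j.toMul)) :=
          SetLike.GradedMul.mul_mem a.2 b.2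
        have hbc : (b : A) * c ∈ 𝒜 (Additive.ofMul (j.toMul * k.toMul)) :=
          SetLike.GradedMul.mul_mem b.2 c.2
        rw [mulAux_of_mem 𝒜 μ (g := i.toMul) (h := j.toMul) a.2 b.2,
          mulAux_of_mem 𝒜 μ (g := j.toMul) (h := k.toMul) b.2 c.2,
          mulAux_smul_left, mulAux_smul_right,
          mulAux_of_mem 𝒜 μ (h := k.toMul) hab c.2, mulAux_of_mem 𝒜 μ (g := i.toMul) a.2 hbc,
          smul_smul, smul_smul, mul_assoc, ← Units.val_mul, ← Units.val_mul, μ.cocycle,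
          mul_comm (μ i.toMul _)]

instance : One (CocycleTwist 𝒜 μ) := ⟨of 𝒜 μ 1⟩

instance : Mul (CocycleTwist 𝒜 μ) :=
  ⟨fun a b => of 𝒜 μ (mulAux 𝒜 μ ((of 𝒜 μ).symm a) ((of 𝒜 μ).symm b))⟩

/-- The cocycle twist `A_μ = (A, ⋆_μ)`. -/
instance instRing : Ring (CocycleTwist 𝒜 μ) where
  __ := (inferInstance : AddCommGroup (CocycleTwist 𝒜 μ))
  left_distrib a b c := mulAux_add_right 𝒜 μ a b c
  right_distrib a b c := mulAux_add_left 𝒜 μ a b c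
  zero_mul a := mulAux_zero_left 𝒜 μ a
  mul_zero a := mulAux_zero_right 𝒜 μ a
  mul_assoc a b c := mulAux_assoc 𝒜 μ a b c
  one_mul a := mulAux_one_left 𝒜 μ a
  mul_one a := mulAux_one_right 𝒜 μ a

instance instAlgebra : Algebra R (CocycleTwist 𝒜 μ) :=
  Algebra.ofModule (fun r a b => mulAux_smul_left 𝒜 μ r a b)
    (fun r a b => mulAux_smul_right 𝒜 μ r a b)

/-- The defining formula of the twisted product. -/
theorem of_mul_of {g h : G} {a b : A} (ha : a ∈ 𝒜 (Additive.ofMul g))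
    (hb : b ∈ 𝒜 (Additive.ofMul h)) :
    of 𝒜 μ a * of 𝒜 μ b = (μ g h : R) • of 𝒜 μ (a * b) :=
  mulAux_of_mem 𝒜 μ ha hb

end CocycleTwist

/-- The extension `(R ⊗_ℂ A)_μ` of a `G`-graded `ℂ`-algebra `A` by a cocycle `μ ∈ Z²(G, Rˣ)`:
the algebra `R ⊗_ℂ A`, graded by the submodules `R ⊗_ℂ A_g`, twisted by `μ`. -/
abbrev CocycleExtension {R A : Type*} [CommRing R] [Algebra ℂ R] [Ring A] [Algebra ℂ A]
    (𝒜 : Additive G → Submodule ℂ A) (μ : TwoCocycle G Rˣ) : Type _ :=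
  CocycleTwist (fun g => (𝒜 g).baseChange R) μ

end Twist

/-- The specialisation `Ã|_{z=ζ} = Ã / (z - ζ)Ã` of an algebra `Ã` over the commutative
`ℂ`-algebra `R ∋ z`. -/
abbrev Specialisation {R : Type*} [CommRing R] [Algebra ℂ R] (B : Type*) [Ring B] [Algebra R B]
    (z : R) (ζ : ℂ) : Type _ :=
  RingQuot (fun a b : B => ∃ c : B, a = (z - algebraMap ℂ R ζ) • c ∧ b = 0)

/-! ## The Yetter–Drinfeld modules `(X_n, q)` -/

/-- The set `X_n` of transpositions in `S_n`. -/
abbrev Transposition (n : ℕ) : Type := {τ : Equiv.Perm (Fin n) // τ.IsSwap}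

/-- `σ τ σ⁻¹`, for a transposition `τ`. -/
def conj {n : ℕ} (σ : Equiv.Perm (Fin n)) (τ : Transposition n) : Transposition n :=
  ⟨σ * τ.1 * σ⁻¹, by
    obtain ⟨i, j, hij, h⟩ := τ.2
    exact ⟨σ i, σ j, fun e => hij (σ.injective e), by rw [h, Equiv.swap_apply_apply]⟩⟩

/-- Functions `q : S_n × X_n → Rˣ` with `q(ρσ, τ) = q(ρ, στσ⁻¹) q(σ, τ)`. -/
structure YDCocycle (n : ℕ) (R : Type*) [CommRing R] where
  toFun : Equiv.Perm (Fin n) → Transposition n → Rˣ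
  cocycle : ∀ ρ σ τ, toFun (ρ * σ) τ = toFun ρ (conj σ τ) * toFun σ τ

instance {n : ℕ} {R : Type*} [CommRing R] :
    CoeFun (YDCocycle n R) (fun _ => Equiv.Perm (Fin n) → Transposition n → Rˣ) :=
  ⟨YDCocycle.toFun⟩

/-- `Inverts σ τ` says that `σ(i) > σ(j)`, where `τ = (i j)` with `i < j`. -/
def Inverts {n : ℕ} (σ : Equiv.Perm (Fin n)) (τ : Transposition n) : Prop :=
  ∃ i j : Fin n, i < j ∧ τ.1 = Equiv.swap i j ∧ σ j < σ i

theorem swap_eq_of_lt {n : ℕ} {i j k l : Fin n} (hij : i < j) (hkl : k < l)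
    (h : Equiv.swap i j = Equiv.swap k l) : i = k ∧ j = l := by
  have h1 := congrArg (fun f => f i) h
  have h2 := congrArg (fun f => f j) h
  simp only [Equiv.swap_apply_left, Equiv.swap_apply_right, Equiv.swap_apply_def] at h1 h2
  split_ifs at h1 h2 <;> grind

theorem exists_lt_swap {n : ℕ} (τ : Transposition n) :
    ∃ i j : Fin n, i < j ∧ τ.1 = Equiv.swap i j := by
  obtain ⟨i, j, hij, h⟩ := τ.2
  rcases lt_or_gt_of_ne hij with h' | h'
  · exact ⟨i, j, h', h⟩
  · exact ⟨j, i, h', by rw [h, Equiv.swap_comm]⟩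

theorem inverts_iff {n : ℕ} (σ : Equiv.Perm (Fin n)) (τ : Transposition n) {i j : Fin n}
    (hij : i < j) (h : τ.1 = Equiv.swap i j) : Inverts σ τ ↔ σ j < σ i := by
  constructor
  · rintro ⟨k, l, hkl, hs, hlt⟩
    obtain ⟨rfl, rfl⟩ := swap_eq_of_lt hij hkl (h.symm.trans hs)
    exact hlt
  · exact fun hlt => ⟨i, j, hij, h, hlt⟩

theorem inverts_mul {n : ℕ} (ρ σ : Equiv.Perm (Fin n)) (τ : Transposition n) :
    Inverts (ρ * σ) τ ↔ ¬ (Inverts ρ (conj σ τ) ↔ Inverts σ τ) := by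
  obtain ⟨i, j, hij, h⟩ := exists_lt_swap τ
  have hc : (conj σ τ).1 = Equiv.swap (σ i) (σ j) := by
    simp only [conj, h, Equiv.swap_apply_apply]
  have hne : σ i ≠ σ j := fun e => hij.ne (σ.injective e)
  have hne' : ρ (σ i) ≠ ρ (σ j) := fun e => hne (ρ.injective e)
  rw [inverts_iff _ τ hij h, inverts_iff σ τ hij h]
  simp only [Equiv.Perm.mul_apply]
  rcases lt_or_gt_of_ne hne with h' | h'
  · rw [inverts_iff ρ _ h' hc]
    have := h'.not_gt
    tauto
  · rw [inverts_iff ρ _ h' (hc.trans (Equiv.swap_comm _ _))]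
    rcases lt_or_gt_of_ne hne' with h'' | h''
    · have := h''.not_gt
      tauto
    · have := h''.not_gt
      tauto

open Classical in
/-- The cocycle `q_u`, for `u ∈ Rˣ` with `u² = 1`, which on transpositions `σ` and `(i j)`,
`i < j`, is given by `q_u(σ, (i j)) = u` if `σ(i) < σ(j)` and `-1` if `σ(i) > σ(j)`
(see `qCocycle_apply`). -/
def qCocycle (n : ℕ) {R : Type*} [CommRing R] (u : Rˣ) (hu : u * u = 1) : YDCocycle n R where
  toFun σ τ := (if Equiv.Perm.sign σ = 1 then 1 else u) * (if Inverts σ τ then -u else 1)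
  cocycle ρ σ τ := by
    rw [Equiv.Perm.sign_mul]
    simp only [inverts_mul]
    rcases Int.units_eq_one_or (Equiv.Perm.sign ρ) with h1 | h1 <;>
    rcases Int.units_eq_one_or (Equiv.Perm.sign σ) with h2 | h2 <;>
    by_cases h3 : Inverts ρ (conj σ τ) <;> by_cases h4 : Inverts σ τ <;>
    simp [h1, h2, h3, h4, hu]

open Classical in
theorem qCocycle_apply (n : ℕ) {R : Type*} [CommRing R] (u : Rˣ) (hu : u * u = 1)
    (σ τ : Transposition n) {i j : Fin n} (hij : i < j) (hτ : τ.1 = Equiv.swap i j) :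
    qCocycle n u hu σ.1 τ = if σ.1 i < σ.1 j then u else -1 := by
  have hs : Equiv.Perm.sign σ.1 = -1 := σ.2.sign_eq
  have hne : σ.1 i ≠ σ.1 j := fun e => hij.ne (σ.1.injective e)
  simp only [qCocycle, hs, inverts_iff σ.1 τ hij hτ]
  rcases lt_or_gt_of_ne hne with h | h
  · simp [h, h.not_gt]
  · simp [h, h.not_gt, hu]

/-- The braiding `Ψ(e_τ ⊗ e_υ) = q(τ, υ) e_{τυτ⁻¹} ⊗ e_τ` of the Yetter–Drinfeld module
`(X_n, q)`: the free `R`-module on `X_n` with `S_n`-action `σ ▷ e_τ = q(σ, τ) e_{στσ⁻¹}` and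
with `e_τ` in degree `τ`. -/
def braiding {n : ℕ} {R : Type*} [CommRing R] (q : YDCocycle n R) :
    Module.End R ((Transposition n →₀ R) ⊗[R] (Transposition n →₀ R)) :=
  (Finsupp.basisSingleOne.tensorProduct Finsupp.basisSingleOne).constr R
    fun p : Transposition n × Transposition n =>
      (q p.1.1 p.2 : R) • (Finsupp.single (conj p.1.1 p.2) 1 ⊗ₜ[R] Finsupp.single p.1 1)

/-- The algebra `𝓑(X_n, q)`, over a commutative ring `R`. -/
abbrev BX {n : ℕ} {R : Type*} [CommRing R] (q : YDCocycle n R) : Type _ :=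
  NicholsAlgebra (braiding q)

/-- The generator `e_τ` of `𝓑(X_n, q)`. -/
def e {n : ℕ} {R : Type*} [CommRing R] (q : YDCocycle n R) (τ : Transposition n) : BX q :=
  NicholsAlgebra.ι (braiding q) (Finsupp.single τ 1)

/-- The component of `𝓑(X_n, q)` of degree `g ∈ S_n`, spanned by the products
`e_{τ₁} ⋯ e_{τ_k}` with `τ₁ ⋯ τ_k = g`. -/
def degree {n : ℕ} {R : Type*} [CommRing R] (q : YDCocycle n R)
    (g : Additive (Equiv.Perm (Fin n))) : Submodule R (BX q) :=
  Submodule.span R {b | ∃ w : List (Transposition n),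
    (w.map Subtype.val).prod = g.toMul ∧ b = (w.map (e q)).prod}

/-! ## The ring `R = ℂC₂` and the cocycle `[1, z]` -/

/-- The cyclic group `C₂ = {1, z}`. -/
abbrev C₂ : Type := Multiplicative (ZMod 2)

/-- The generator of `C₂`. -/
def z₀ : C₂ := Multiplicative.ofAdd 1

/-- The group algebra `ℂC₂ = ℂ[z]/(z² - 1)`. -/
abbrev ℂC₂ : Type := MonoidAlgebra ℂ C₂

/-- The embedding of `C₂` in the group of units of `ℂC₂`. -/
def toUnitsRing : C₂ →* ℂC₂ˣ := (MonoidAlgebra.of ℂ C₂).toHomUnits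

/-- `z`, as a unit of `ℂC₂`. -/
def z : ℂC₂ˣ := toUnitsRing z₀

theorem z_mul_z : z * z = 1 := by
  rw [z, ← map_mul, show z₀ * z₀ = 1 by decide, map_one]

/-- The homomorphism `C₂ → ℂˣ` with `z ↦ -1`. -/
def evalNegOne : C₂ →* ℂˣ where
  toFun c := if c = 1 then 1 else -1
  map_one' := if_pos rfl
  map_mul' := by
    have h : ∀ a b : C₂, (a = 1 ∧ b = 1 ∧ a * b = 1) ∨ (a = 1 ∧ b ≠ 1 ∧ a * b ≠ 1) ∨
        (a ≠ 1 ∧ b = 1 ∧ a * b ≠ 1) ∨ (a ≠ 1 ∧ b ≠ 1 ∧ a * b = 1) := by decide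
    intro a b
    rcases h a b with ⟨h1, h2, h3⟩ | ⟨h1, h2, h3⟩ | ⟨h1, h2, h3⟩ | ⟨h1, h2, h3⟩ <;>
    simp [h1, h2, h3]

/-- For `μ ∈ Z²(S_n, C₂)`, the cocycle `μ · μ|_{z=-1} ∈ Z²(S_n, (ℂC₂)ˣ)`. -/
def mulEval {n : ℕ} (μ : TwoCocycle (Equiv.Perm (Fin n)) C₂) :
    TwoCocycle (Equiv.Perm (Fin n)) ℂC₂ˣ :=
  μ.map toUnitsRing *
    μ.map ((Units.map (algebraMap ℂ ℂC₂ : ℂ →* ℂC₂)).comp evalNegOne)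

/-- The simple transposition `s_i = (i i+1)` of `S_n`, `0 ≤ i`, `i + 1 < n`. -/
def simple {n : ℕ} (i : ℕ) (hi : i + 1 < n) : Equiv.Perm (Fin n) :=
  Equiv.swap ⟨i, Nat.lt_of_succ_lt hi⟩ ⟨i + 1, hi⟩

/-- `μ` belongs to the cohomology class `[α, β] ∈ H²(S_n, C₂)`, that is, `μ` is cohomologous to
a cocycle `ν` with `ν(s_i, s_i) = α`, and `ν(s_k, s_l) = 1`, `ν(s_l, s_k) = β` for `k < l`. -/
def InClass {n : ℕ} (α β : C₂) (μ : TwoCocycle (Equiv.Perm (Fin n)) C₂) : Prop :=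
  ∃ ν : TwoCocycle (Equiv.Perm (Fin n)) C₂, μ.Cohomologous ν ∧
    (∀ i (hi : i + 1 < n), ν (simple i hi) (simple i hi) = α) ∧
    ∀ k l (hk : k + 1 < n) (hl : l + 1 < n), k < l →
      ν (simple k hk) (simple l hl) = 1 ∧ ν (simple l hl) (simple k hk) = β

/-- The cocycle `q_1` with values in `ℂˣ`. -/
abbrev q₁ (n : ℕ) : YDCocycle n ℂ := qCocycle n 1 (one_mul 1)

/-- The cocycle `q_{-1}` with values in `ℂˣ`. -/
abbrev qNeg (n : ℕ) : YDCocycle n ℂ := qCocycle n (-1) (by norm_num)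

/-- The cocycle `q_z` with values in `(ℂC₂)ˣ`. -/
abbrev qz (n : ℕ) : YDCocycle n ℂC₂ := qCocycle n z z_mul_z

/-- The idempotent `(1 + ζ z)/2` of `ℂC₂`, for `ζ = ±1`. -/
def idem (ζ : ℂ) : ℂC₂ := (2⁻¹ : ℂ) • (1 + ζ • (z : ℂC₂))

/-- The two-sided ideal `(1 + ζ z)/2 · 𝓑(ℂC₂ X_n, q_z)`, for `ζ = ±1`. -/
def idealPart (n : ℕ) (ζ : ℂ) : TwoSidedIdeal (BX (qz n)) :=
  TwoSidedIdeal.span {algebraMap ℂC₂ (BX (qz n)) (idem ζ)}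

/-- `F` is an isomorphism from `𝓑(ℂC₂ X_n, q_z)` to the extension of `𝓑(X_n, q)` by `μ` which
respects the `S_n`-gradings and sends `e_τ` to `c(τ) ⊗ e_τ`. -/
def IsExtensionIso {n : ℕ} {q : YDCocycle n ℂ} [GradedAlgebra (degree q)]
    {μ : TwoCocycle (Equiv.Perm (Fin n)) ℂC₂ˣ}
    (F : BX (qz n) ≃ₐ[ℂC₂] CocycleExtension (degree q) μ) (c : Transposition n → ℂC₂ˣ) : Prop :=
  (∀ τ, F (e (qz n) τ) =
    CocycleTwist.of (fun g => (degree q g).baseChange ℂC₂) μ ((c τ : ℂC₂) ⊗ₜ[ℂ] e q τ)) ∧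
  ∀ g, (degree (qz n) g).map F.toLinearMap =
    ((degree q g).baseChange ℂC₂).map
      (CocycleTwist.of (fun g => (degree q g).baseChange ℂC₂) μ).toLinearMap

end SuperNichols

end

/-! The degree-`k` part of `𝓑(X_n, q)` is spanned by words in the transpositions modulo the kernel
of the braided factorial, an operator built from braidings of neighbouring letters. Twisting the
product by a cocycle `ν` and replacing each `e_τ` by `c_τ e_τ` multiplies every word by a unit
(`weight`). If `ν` and `c` carry one braiding to the other (`TwistRel`), this diagonal rescaling
intertwines the two factorials (`rescale_wordFactorial`) and so matches their kernels. The relations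
therefore hold in the twist (`Satisfies.twist`), and the inverse cocycle supplies the inverse map
(`exists_algEquiv_cocycleExtension`). The rescaling is semilinear, so it also handles changes of
scalars; with an indicator function as weight it shows that the relations are homogeneous for the
`S_n`-degree.

The cocycle extensions are thereby reduced to group cohomology. On transpositions `q_z / q_1` is `1`
if `τ` inverts `υ` and `z` otherwise, while `q_z / q_{-1}` is `1` or `-z`. What is needed is a
function `c` with `μ(τ, υ) c_υ = twistSign(τ, υ) μ(τυτ⁻¹, τ) c_{τυτ⁻¹}`. A representative with `c =
1` (`exists_inClass`) comes from a Clifford algebra: `(i j)` with `i < j` is lifted to the unit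
vector `e_i - e_j`. Conjugation by a unit vector is minus the reflection, and this sign is cancelled
exactly when a positive root becomes negative, that is, when `τ` inverts `υ`. Modulo `±1` the lifts
satisfy the relations of `S_n`, and a section of the resulting central extension yields `μ`. For an
arbitrary representative (`InClass.exists_rescaling`), conjugation in the extension and `twistSign`
both come from functions with the cocycle property `IsYD`. As `S_n` acts transitively on `X_n`, it
suffices to compare them on the stabiliser of `(0 1)`, as in Shapiro's lemma. That group is
generated by `s_0` and the `s_k` with `k ≥ 2`, where the normalisation of `[1, z]` gives the values.

For the specialisations, `ℂC₂ ≅ ℂ × ℂ` through the idempotents `(1 ± z)/2`, so an element vanishes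
once its values at `z = ±1` do. Hence a relation for `q_ζ`, multiplied by `(1 + ζz)/2`, is a
relation for `q_z` (`idem_smul_linearCombination_eq_zero`). The kernel of the evaluation at `ζ` is
then the annihilator of that idempotent, which gives the specialisations and the product
decomposition. Freeness holds because a cocycle extension has underlying module `ℂC₂ ⊗ 𝓑(X_n, q_1)`.
-/

noncomputable section

namespace SuperNichols

/-! ## Words in the transpositions -/

section Words

variable {n : ℕ}

/-- Words of length `k` in the transpositions. -/
inductive Word (n : ℕ) : ℕ → Type
  | nil : Word n 0
  | snoc {k : ℕ} : Word n k → Transposition n → Word n (k + 1)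

/-- There is exactly one word of length `0`. -/
instance : Unique (Word n 0) where
  default := .nil
  uniq | .nil => rfl

/-- A nonempty word is a shorter word followed by a letter. -/
def wordSuccEquiv (n k : ℕ) : Word n k × Transposition n ≃ Word n (k + 1) where
  toFun p := p.1.snoc p.2
  invFun | .snoc w τ => (w, τ)
  left_inv _ := rfl
  right_inv | .snoc _ _ => rfl

/-- The product `a_{τ₁} ⋯ a_{τ_k}` along a word `τ₁ ⋯ τ_k`. -/
def wordProd {A : Type*} [Monoid A] (a : Transposition n → A) : {k : ℕ} → Word n k → A
  | _, .nil => 1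
  | _, .snoc w τ => wordProd a w * a τ

theorem map_wordProd {A B F : Type*} [Monoid A] [Monoid B] [FunLike F A B] [MonoidHomClass F A B]
    (f : F) (a : Transposition n → A) {k : ℕ} (w : Word n k) :
    f (wordProd a w) = wordProd (fun τ => f (a τ)) w := by
  induction w with
  | nil => exact map_one f
  | snoc w τ ih => rw [wordProd, wordProd, map_mul, ih]

variable {R : Type*} [CommRing R]

/-- Appending the letter `τ` to all words of length `k`. -/
def snocWord (R : Type*) [CommRing R] (k : ℕ) (τ : Transposition n) :
    (Word n k →₀ R) →ₗ[R] (Word n (k + 1) →₀ R) :=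
  Finsupp.lmapDomain R R (fun w => w.snoc τ)

theorem snocWord_single (k : ℕ) (τ : Transposition n) (w : Word n k) (r : R) :
    snocWord R k τ (Finsupp.single w r) = Finsupp.single (w.snoc τ) r :=
  Finsupp.mapDomain_single

/-- Additive statements on combinations of words of length `k + 1` can be checked on combinations
of words with a fixed last letter. -/
theorem snocWord_induction {k : ℕ} {p : (Word n (k + 1) →₀ R) → Prop} (h0 : p 0)
    (hadd : ∀ x y, p x → p y → p (x + y)) (h : ∀ τ y, p (snocWord R k τ y)) (x) : p x := by
  induction x using Finsupp.induction_linear with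
  | zero => exact h0
  | add x y hx hy => exact hadd x y hx hy
  | single w r =>
    cases w with
    | snoc w τ => exact snocWord_single k τ w r ▸ h τ (Finsupp.single w r)

/-- The isomorphism `W_k ⊗ V ≃ W_{k+1}`, where `W_k` is spanned by the words of length `k`. -/
def wordTensor (R : Type*) [CommRing R] (n k : ℕ) :
    (Word n k →₀ R) ⊗[R] (Transposition n →₀ R) ≃ₗ[R] (Word n (k + 1) →₀ R) :=
  (finsuppTensorFinsupp' R (Word n k) (Transposition n)).trans
    (Finsupp.domLCongr (wordSuccEquiv n k))

theorem wordTensor_tmul_single (k : ℕ) (y : Word n k →₀ R) (τ : Transposition n) :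
    wordTensor R n k (y ⊗ₜ Finsupp.single τ 1) = snocWord R k τ y := by
  induction y using Finsupp.induction_linear with
  | zero => rw [TensorProduct.zero_tmul, map_zero, map_zero]
  | add x y hx hy => rw [TensorProduct.add_tmul, map_add, map_add, hx, hy]
  | single w r =>
    rw [snocWord_single, wordTensor, LinearEquiv.trans_apply,
      finsuppTensorFinsupp'_single_tmul_single, mul_one, Finsupp.domLCongr_single]
    rfl

/-- The coordinates of `V^{⊗k}` with respect to the basis of words. -/
def wordEquiv (R : Type*) [CommRing R] (n : ℕ) :
    (k : ℕ) → (⨂[R]^k (Transposition n →₀ R)) ≃ₗ[R] (Word n k →₀ R)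
  | 0 => (PiTensorProduct.isEmptyEquiv (Fin 0)).trans
      (Finsupp.uniqueLinearEquiv R R Word.nil).symm
  | k + 1 => ((snoc R _ k).symm.trans
      (TensorProduct.congr (wordEquiv R n k) (LinearEquiv.refl R _))).trans (wordTensor R n k)

theorem wordEquiv_snoc (k : ℕ) (t : ⨂[R]^k (Transposition n →₀ R)) (τ : Transposition n) :
    wordEquiv R n (k + 1) (snoc R _ k (t ⊗ₜ Finsupp.single τ 1)) =
      snocWord R k τ (wordEquiv R n k t) := by
  simp only [wordEquiv, LinearEquiv.trans_apply, LinearEquiv.symm_apply_apply,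
    TensorProduct.congr_tmul, LinearEquiv.refl_apply, wordTensor_tmul_single]

theorem tensorPower_snoc_induction {k : ℕ} {p : (⨂[R]^(k + 1) (Transposition n →₀ R)) → Prop}
    (h0 : p 0) (hadd : ∀ x y, p x → p y → p (x + y))
    (h : ∀ t τ, p (snoc R _ k (t ⊗ₜ Finsupp.single τ 1))) (x) : p x := by
  obtain ⟨y, rfl⟩ := (wordEquiv R n (k + 1)).symm.surjective x
  induction y using snocWord_induction with
  | h0 => rwa [map_zero]
  | hadd x y hx hy => rw [map_add]; exact hadd _ _ hx hy
  | h τ y =>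
    rw [← LinearEquiv.apply_symm_apply (wordEquiv R n k) y, ← wordEquiv_snoc,
      LinearEquiv.symm_apply_apply]
    exact h _ τ

theorem toTensorAlgebra_snoc {V : Type*} [AddCommGroup V] [Module R V] (k : ℕ) (t : ⨂[R]^k V)
    (v : V) : TensorPower.toTensorAlgebra (snoc R V k (t ⊗ₜ v)) =
      TensorPower.toTensorAlgebra t * TensorAlgebra.ι R v := by
  have h := TensorPower.toTensorAlgebra_gMul t
    ((PiTensorProduct.subsingletonEquiv (R := R) (s := fun _ : Fin 1 => V) 0).symm v)
  rw [TensorPower.gMul_def] at h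
  simp only [snoc, LinearEquiv.trans_apply, TensorProduct.congr_tmul, LinearEquiv.refl_apply]
  rw [h]
  congr 1
  rw [PiTensorProduct.subsingletonEquiv_symm_apply']
  simp [TensorAlgebra.tprod_apply]

theorem toTensorAlgebra_wordEquiv_symm {k : ℕ} (y : Word n k →₀ R) :
    TensorPower.toTensorAlgebra ((wordEquiv R n k).symm y) =
      Finsupp.linearCombination R
        (wordProd (fun τ => TensorAlgebra.ι R (Finsupp.single τ (1 : R)))) y := by
  induction y using Finsupp.induction_linear with
  | zero => simp only [map_zero]
  | add x y hx hy => simp only [map_add, hx, hy]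
  | single w r =>
    rw [← mul_one r, ← smul_eq_mul, ← Finsupp.smul_single, map_smul, map_smul, map_smul,
      Finsupp.linearCombination_single, one_smul]
    congr 1
    induction w with
    | nil =>
      have : (wordEquiv R n 0).symm (Finsupp.single .nil 1) =
          PiTensorProduct.tprod R (@isEmptyElim _ _ _) := by
        rw [LinearEquiv.symm_apply_eq, wordEquiv, LinearEquiv.trans_apply,
          PiTensorProduct.isEmptyEquiv_apply_tprod, LinearEquiv.eq_symm_apply]
        simp
      rw [this, TensorPower.toTensorAlgebra_tprod]
      simp [wordProd, TensorAlgebra.tprod_apply]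
    | @snoc k w τ ih =>
      have h1 : (wordEquiv R n (k + 1)).symm (Finsupp.single (w.snoc τ) 1) =
          snoc R _ k ((wordEquiv R n k).symm (Finsupp.single w 1) ⊗ₜ Finsupp.single τ 1) := by
        rw [LinearEquiv.symm_apply_eq, wordEquiv_snoc, LinearEquiv.apply_symm_apply,
          snocWord_single]
      rw [h1, toTensorAlgebra_snoc, ih, wordProd]

/-! ### The braided factorial in coordinates -/

/-- `f ⊗ id_V` in coordinates. -/
def wordTensorId {k : ℕ} (f : Module.End R (Word n k →₀ R)) : Module.End R (Word n (k + 1) →₀ R) :=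
  (wordTensor R n k).toLinearMap ∘ₗ f.rTensor _ ∘ₗ (wordTensor R n k).symm.toLinearMap

theorem wordTensorId_snocWord {k : ℕ} (f : Module.End R (Word n k →₀ R)) (τ : Transposition n)
    (y : Word n k →₀ R) : wordTensorId f (snocWord R k τ y) = snocWord R k τ (f y) := by
  rw [← wordTensor_tmul_single, ← wordTensor_tmul_single]
  simp [wordTensorId]

/-- The braiding of the last two letters of a word. -/
def wordLegAux (q : YDCocycle n R) (k : ℕ) : Word n (k + 2) → (Word n (k + 2) →₀ R)
  | .snoc (.snoc w τ) υ => (q τ.1 υ : R) • Finsupp.single ((w.snoc (conj τ.1 υ)).snoc τ) 1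

/-- The braiding of the last two letters in coordinates. -/
def wordLeg (q : YDCocycle n R) (k : ℕ) : Module.End R (Word n (k + 2) →₀ R) :=
  Finsupp.linearCombination R (wordLegAux q k)

theorem wordLeg_snocWord (q : YDCocycle n R) (k : ℕ) (τ υ : Transposition n) (y : Word n k →₀ R) :
    wordLeg q k (snocWord R (k + 1) υ (snocWord R k τ y)) =
      (q τ.1 υ : R) • snocWord R (k + 1) τ (snocWord R k (conj τ.1 υ) y) := by
  induction y using Finsupp.induction_linear with
  | zero => simp only [map_zero, smul_zero]
  | add x y hx hy => simp only [map_add, smul_add, hx, hy]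
  | single w r =>
    simp only [snocWord_single, wordLeg, Finsupp.linearCombination_single, wordLegAux,
      Finsupp.smul_single, smul_eq_mul, mul_one, mul_comm r]

/-- The braided integers in coordinates. -/
def wordInt (q : YDCocycle n R) : (k : ℕ) → Module.End R (Word n (k + 1) →₀ R)
  | 0 => LinearMap.id
  | k + 1 => LinearMap.id + wordLeg q k ∘ₗ wordTensorId (wordInt q k)

/-- The braided factorials in coordinates. -/
def wordFactorial (q : YDCocycle n R) : (k : ℕ) → Module.End R (Word n k →₀ R)
  | 0 => LinearMap.id
  | k + 1 => wordTensorId (wordFactorial q k) ∘ₗ wordInt q k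

theorem wordEquiv_tensorId {k : ℕ} {f : Module.End R (⨂[R]^k (Transposition n →₀ R))}
    {f' : Module.End R (Word n k →₀ R)} (h : ∀ t, wordEquiv R n k (f t) = f' (wordEquiv R n k t))
    (t : ⨂[R]^(k + 1) (Transposition n →₀ R)) :
    wordEquiv R n (k + 1) (tensorId f t) = wordTensorId f' (wordEquiv R n (k + 1) t) := by
  induction t using tensorPower_snoc_induction with
  | h0 => simp only [map_zero]
  | hadd x y hx hy => simp only [map_add, hx, hy]
  | h t τ =>
    rw [wordEquiv_snoc, wordTensorId_snocWord, ← h, ← wordEquiv_snoc]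
    simp [tensorId]

theorem braiding_single (q : YDCocycle n R) (τ υ : Transposition n) :
    braiding q (Finsupp.single τ 1 ⊗ₜ Finsupp.single υ 1) =
      (q τ.1 υ : R) • (Finsupp.single (conj τ.1 υ) 1 ⊗ₜ[R] Finsupp.single τ 1) := by
  have := ((Finsupp.basisSingleOne (R := R)).tensorProduct
    (Finsupp.basisSingleOne (R := R))).constr_basis R
    (fun p : Transposition n × Transposition n =>
      (q p.1.1 p.2 : R) • ((Finsupp.single (conj p.1.1 p.2) 1 : Transposition n →₀ R) ⊗ₜ[R]
        (Finsupp.single p.1 1 : Transposition n →₀ R))) (τ, υ)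
  rwa [Module.Basis.tensorProduct_apply, Finsupp.coe_basisSingleOne] at this

theorem wordEquiv_lastLeg (q : YDCocycle n R) (k : ℕ)
    (t : ⨂[R]^(k + 2) (Transposition n →₀ R)) :
    wordEquiv R n (k + 2) (lastLeg (braiding q) k t) =
      wordLeg q k (wordEquiv R n (k + 2) t) := by
  induction t using tensorPower_snoc_induction with
  | h0 => simp only [map_zero]
  | hadd x y hx hy => simp only [map_add, hx, hy]
  | h t υ =>
    induction t using tensorPower_snoc_induction with
    | h0 => simp only [map_zero, TensorProduct.zero_tmul]
    | hadd x y hx hy => simp only [map_add, TensorProduct.add_tmul, hx, hy]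
    | h t τ =>
      rw [wordEquiv_snoc, wordEquiv_snoc, wordLeg_snocWord]
      simp only [lastLeg, LinearMap.comp_apply, LinearEquiv.coe_coe, LinearEquiv.trans_symm,
        LinearEquiv.symm_symm, LinearEquiv.trans_apply, LinearEquiv.symm_apply_apply,
        TensorProduct.congr_symm_tmul, LinearEquiv.refl_symm, LinearEquiv.refl_apply,
        TensorProduct.assoc_tmul, LinearMap.lTensor_tmul, braiding_single,
        TensorProduct.tmul_smul, map_smul, TensorProduct.assoc_symm_tmul,
        TensorProduct.congr_tmul, wordEquiv_snoc]

theorem wordEquiv_braidedInt (q : YDCocycle n R) (k : ℕ)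
    (t : ⨂[R]^(k + 1) (Transposition n →₀ R)) :
    wordEquiv R n (k + 1) (braidedInt (braiding q) k t) =
      wordInt q k (wordEquiv R n (k + 1) t) := by
  induction k with
  | zero => rfl
  | succ k ih =>
    simp only [braidedInt, wordInt, LinearMap.add_apply, LinearMap.id_apply,
      LinearMap.comp_apply, map_add, wordEquiv_lastLeg, wordEquiv_tensorId ih]

theorem wordEquiv_braidedFactorial (q : YDCocycle n R) (k : ℕ)
    (t : ⨂[R]^k (Transposition n →₀ R)) :
    wordEquiv R n k (braidedFactorial (braiding q) k t) =
      wordFactorial q k (wordEquiv R n k t) := by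
  induction k with
  | zero => rfl
  | succ k ih =>
    simp only [braidedFactorial, wordFactorial, LinearMap.comp_apply, wordEquiv_tensorId ih,
      wordEquiv_braidedInt]

/-! ### Rescaling of words -/

variable {R' : Type*} [CommRing R']

/-- The scalar `ψ(τ₁⋯τ_k) κ(1, τ₁) κ(τ₁, τ₂) κ(τ₁τ₂, τ₃) ⋯` of a word. -/
def weight (κ : Equiv.Perm (Fin n) → Transposition n → R') :
    {k : ℕ} → (Equiv.Perm (Fin n) → R') → Word n k → R'
  | _, ψ, .nil => ψ 1
  | _, ψ, .snoc w τ => weight κ (fun g => ψ (g * τ.1) * κ g τ) w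

/-- The function `ψ` is an accumulator: it lets the weight be computed by removing letters from the
right, although each factor `κ` depends on the product of the letters to its left. -/
theorem weight_eq (κ : Equiv.Perm (Fin n) → Transposition n → R')
    (ψ : Equiv.Perm (Fin n) → R') {k : ℕ} (w : Word n k) :
    weight κ ψ w = ψ (wordProd Subtype.val w) * weight κ 1 w := by
  induction w generalizing ψ with
  | nil => exact (mul_one _).symm
  | snoc w τ ih =>
    rw [weight, ih, weight, ih (fun g => (1 : Equiv.Perm (Fin n) → R') (g * τ.1) * κ g τ),
      wordProd]
    simp [mul_assoc]

theorem weight_one_snoc (κ : Equiv.Perm (Fin n) → Transposition n → R') {k : ℕ}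
    (w : Word n k) (τ : Transposition n) :
    weight κ 1 (w.snoc τ) = κ (wordProd Subtype.val w) τ * weight κ 1 w := by
  rw [weight, weight_eq]
  simp

/-- The semilinear map which rescales words by their weights. -/
def rescale (h : R →+* R') (κ : Equiv.Perm (Fin n) → Transposition n → R')
    (ψ : Equiv.Perm (Fin n) → R') (k : ℕ) : (Word n k →₀ R) →+ (Word n k →₀ R') :=
  Finsupp.liftAddHom fun w =>
    (Finsupp.singleAddHom w).comp ((AddMonoidHom.mulLeft (weight κ ψ w)).comp h.toAddMonoidHom)

theorem rescale_single (h : R →+* R') (κ : Equiv.Perm (Fin n) → Transposition n → R')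
    (ψ : Equiv.Perm (Fin n) → R') (k : ℕ) (w : Word n k) (r : R) :
    rescale h κ ψ k (Finsupp.single w r) = Finsupp.single w (weight κ ψ w * h r) := by
  simp [rescale]

/-- Removing a letter changes the accumulator, which is why the intertwining statements below are
proved for all `ψ` simultaneously. -/
theorem rescale_snocWord (h : R →+* R') (κ : Equiv.Perm (Fin n) → Transposition n → R')
    (ψ : Equiv.Perm (Fin n) → R') (k : ℕ) (τ : Transposition n) (y : Word n k →₀ R) :
    rescale h κ ψ (k + 1) (snocWord R k τ y) =
      snocWord R' k τ (rescale h κ (fun g => ψ (g * τ.1) * κ g τ) k y) := by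
  induction y using Finsupp.induction_linear with
  | zero => simp only [map_zero]
  | add x y hx hy => simp only [map_add, hx, hy]
  | single w r => simp only [snocWord_single, rescale_single]; rfl

theorem rescale_smul_weight (h : R →+* R') (κ : Equiv.Perm (Fin n) → Transposition n → R')
    (ψ : Equiv.Perm (Fin n) → R') (k : ℕ) (c : R') (y : Word n k →₀ R) :
    c • rescale h κ ψ k y = rescale h κ (fun g => c * ψ g) k y := by
  induction y using Finsupp.induction_linear with
  | zero => simp only [map_zero, smul_zero]
  | add x y hx hy => simp only [map_add, smul_add, hx, hy]
  | single w r =>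
    rw [rescale_single, rescale_single, weight_eq, weight_eq κ (fun g => c * ψ g)]
    rw [Finsupp.smul_single, smul_eq_mul, mul_assoc, mul_assoc, mul_assoc]

theorem rescale_smul (h : R →+* R') (κ : Equiv.Perm (Fin n) → Transposition n → R')
    (ψ : Equiv.Perm (Fin n) → R') (k : ℕ) (r : R) (y : Word n k →₀ R) :
    rescale h κ ψ k (r • y) = h r • rescale h κ ψ k y := by
  induction y using Finsupp.induction_linear with
  | zero => simp only [map_zero, smul_zero]
  | add x y hx hy => simp only [map_add, smul_add, hx, hy]
  | single w s =>
    rw [Finsupp.smul_single, rescale_single, rescale_single, Finsupp.smul_single, smul_eq_mul,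
      smul_eq_mul, map_mul, mul_left_comm]

variable {h : R →+* R'} {κ : Equiv.Perm (Fin n) → Transposition n → R'}

theorem rescale_wordTensorId {k : ℕ} {f : Module.End R (Word n k →₀ R)}
    {f' : Module.End R' (Word n k →₀ R')}
    (hf : ∀ ψ y, rescale h κ ψ k (f y) = f' (rescale h κ ψ k y))
    (ψ : Equiv.Perm (Fin n) → R') (y : Word n (k + 1) →₀ R) :
    rescale h κ ψ (k + 1) (wordTensorId f y) = wordTensorId f' (rescale h κ ψ (k + 1) y) := by
  induction y using snocWord_induction with
  | h0 => simp only [map_zero]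
  | hadd x y hx hy => simp only [map_add, hx, hy]
  | h τ y => rw [wordTensorId_snocWord, rescale_snocWord, rescale_snocWord, hf,
      wordTensorId_snocWord]

/-- The compatibility of two braidings with a rescaling of words. -/
def Compatible (h : R →+* R') (κ : Equiv.Perm (Fin n) → Transposition n → R')
    (q : YDCocycle n R) (q' : YDCocycle n R') : Prop :=
  ∀ (g : Equiv.Perm (Fin n)) (τ υ : Transposition n),
    (q' τ.1 υ : R') * (κ g τ * κ (g * τ.1) υ) =
      h (q τ.1 υ) * (κ g (conj τ.1 υ) * κ (g * (conj τ.1 υ).1) τ)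

variable {q : YDCocycle n R} {q' : YDCocycle n R'}

/-- Braiding the last two letters preserves the total product, since `g (τυτ⁻¹) τ = g τ υ`, so both
sides carry the same value of `ψ`. After the scalars are absorbed into the accumulator, what remains
is `Compatible` with `g` the product of the preceding letters. -/
theorem rescale_wordLeg (hq : Compatible h κ q q') (ψ : Equiv.Perm (Fin n) → R') (k : ℕ)
    (y : Word n (k + 2) →₀ R) :
    rescale h κ ψ (k + 2) (wordLeg q k y) = wordLeg q' k (rescale h κ ψ (k + 2) y) := by
  induction y using snocWord_induction with
  | h0 => simp only [map_zero]
  | hadd x y hx hy => simp only [map_add, hx, hy]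
  | h υ y =>
    induction y using snocWord_induction with
    | h0 => simp only [map_zero]
    | hadd x y hx hy => simp only [map_add, hx, hy]
    | h τ y =>
      rw [wordLeg_snocWord, rescale_smul, rescale_snocWord, rescale_snocWord, rescale_snocWord,
        rescale_snocWord, wordLeg_snocWord]
      simp only [← map_smul, rescale_smul_weight]
      have hc : ∀ g : Equiv.Perm (Fin n), g * (conj τ.1 υ).1 * τ.1 = g * τ.1 * υ.1 := by
        intro g; simp [conj, mul_assoc]
      congr 3
      refine congrArg (fun ψ => rescale h κ ψ k) (funext fun g => ?_)
      rw [hc]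
      linear_combination (-(ψ (g * τ.1 * υ.1))) * hq g τ υ

theorem rescale_wordInt (hq : Compatible h κ q q') (ψ : Equiv.Perm (Fin n) → R') (k : ℕ)
    (y : Word n (k + 1) →₀ R) :
    rescale h κ ψ (k + 1) (wordInt q k y) = wordInt q' k (rescale h κ ψ (k + 1) y) := by
  induction k generalizing ψ with
  | zero => rfl
  | succ k ih =>
    simp only [wordInt, LinearMap.add_apply, LinearMap.id_apply, LinearMap.comp_apply, map_add,
      rescale_wordLeg hq, rescale_wordTensorId ih]

/-- Rescaling of words intertwines the braided factorials. -/
theorem rescale_wordFactorial (hq : Compatible h κ q q') (ψ : Equiv.Perm (Fin n) → R') (k : ℕ)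
    (y : Word n k →₀ R) :
    rescale h κ ψ k (wordFactorial q k y) = wordFactorial q' k (rescale h κ ψ k y) := by
  induction k generalizing ψ with
  | zero => rfl
  | succ k ih =>
    simp only [wordFactorial, LinearMap.comp_apply, rescale_wordTensorId ih, rescale_wordInt hq]

end Words

/-! ## Universal property and grading of `𝓑(X_n, q)` -/

section Universal

variable {n : ℕ} {R : Type*} [CommRing R]

/-- The elements `a τ` satisfy the relations of `𝓑(X_n, q)`. -/
def Satisfies (q : YDCocycle n R) {A : Type*} [Semiring A] [Algebra R A]
    (a : Transposition n → A) : Prop :=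
  ∀ ⦃k : ℕ⦄ (y : Word n k →₀ R), wordFactorial q k y = 0 →
    Finsupp.linearCombination R (wordProd a) y = 0

theorem satisfies_e (q : YDCocycle n R) : Satisfies q (e q) := by
  intro k y hy
  have ht : (wordEquiv R n k).symm y ∈ LinearMap.ker (braidedFactorial (braiding q) k) := by
    rw [LinearMap.mem_ker, ← (wordEquiv R n k).map_eq_zero_iff, wordEquiv_braidedFactorial,
      LinearEquiv.apply_symm_apply, hy]
  have h := RingQuot.mkAlgHom_rel R (s := fun a b : TensorAlgebra R (Transposition n →₀ R) =>
    ∃ (k : ℕ) (t : ⨂[R]^k (Transposition n →₀ R)),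
      t ∈ LinearMap.ker (braidedFactorial (braiding q) k) ∧
        a = TensorPower.toTensorAlgebra t ∧ b = 0) ⟨k, _, ht, rfl, rfl⟩
  rw [map_zero, toTensorAlgebra_wordEquiv_symm, ← AlgHom.coe_toLinearMap,
    Finsupp.apply_linearCombination] at h
  rw [← h]
  congr 2
  funext w
  exact (map_wordProd (RingQuot.mkAlgHom R _) _ w).symm

/-- The universal property of `𝓑(X_n, q)`. -/
def liftBX {q : YDCocycle n R} {A : Type*} [Semiring A] [Algebra R A] (a : Transposition n → A)
    (ha : Satisfies q a) : BX q →ₐ[R] A :=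
  RingQuot.liftAlgHom R ⟨TensorAlgebra.lift R (Finsupp.linearCombination R a), by
    rintro _ _ ⟨k, t, ht, rfl, rfl⟩
    rw [LinearMap.mem_ker, ← (wordEquiv R n k).map_eq_zero_iff, wordEquiv_braidedFactorial] at ht
    have h := ha _ ht
    obtain ⟨y, rfl⟩ := (wordEquiv R n k).symm.surjective t
    rw [map_zero, toTensorAlgebra_wordEquiv_symm, ← AlgHom.coe_toLinearMap,
      Finsupp.apply_linearCombination]
    rw [LinearEquiv.apply_symm_apply] at h
    rw [← h]
    congr 2
    funext w
    refine (map_wordProd (TensorAlgebra.lift R (Finsupp.linearCombination R a)) _ w).trans ?_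
    simp⟩

theorem liftBX_e {q : YDCocycle n R} {A : Type*} [Semiring A] [Algebra R A] (a : Transposition n → A)
    (ha : Satisfies q a) (τ : Transposition n) : liftBX a ha (e q τ) = a τ := by
  simp [liftBX, e, NicholsAlgebra.ι]

/-- The letters of a word. -/
def Word.toList : {k : ℕ} → Word n k → List (Transposition n)
  | _, .nil => []
  | _, .snoc w τ => w.toList ++ [τ]

theorem wordProd_eq_prod {A : Type*} [Monoid A] (a : Transposition n → A) {k : ℕ} (w : Word n k) :
    wordProd a w = (w.toList.map a).prod := by
  induction w with
  | nil => rfl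
  | snoc w τ ih => simp [wordProd, Word.toList, ih]

theorem Word.exists_toList (l : List (Transposition n)) : ∃ (k : ℕ) (w : Word n k), w.toList = l := by
  induction l using List.reverseRecOn with
  | nil => exact ⟨0, .nil, rfl⟩
  | append_singleton l τ ih =>
    obtain ⟨k, w, rfl⟩ := ih
    exact ⟨k + 1, w.snoc τ, rfl⟩

theorem adjoin_range_e (q : YDCocycle n R) : Algebra.adjoin R (Set.range (e q)) = ⊤ := by
  rw [eq_top_iff]
  rintro b -
  obtain ⟨t, rfl⟩ := RingQuot.mkAlgHom_surjective R _ b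
  induction t using TensorAlgebra.induction with
  | algebraMap r => rw [AlgHom.commutes]; exact Subalgebra.algebraMap_mem _ r
  | add x y hx hy => rw [map_add]; exact add_mem hx hy
  | mul x y hx hy => rw [map_mul]; exact mul_mem hx hy
  | ι v =>
    induction v using Finsupp.induction_linear with
    | zero => simp only [map_zero]; exact zero_mem _
    | add x y hx hy => simp only [map_add]; exact add_mem hx hy
    | single τ r =>
      rw [← mul_one r, ← smul_eq_mul, ← Finsupp.smul_single, map_smul, map_smul]
      exact Subalgebra.smul_mem _ (Algebra.subset_adjoin (Set.mem_range_self τ)) r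

theorem span_wordProd (q : YDCocycle n R) :
    Submodule.span R {b | ∃ (k : ℕ) (w : Word n k), b = wordProd (e q) w} = ⊤ := by
  rw [eq_top_iff, ← Algebra.top_toSubmodule, ← adjoin_range_e, Algebra.adjoin_eq_span,
    Submodule.span_le]
  intro b hb
  obtain ⟨l, hl, rfl⟩ := Submonoid.exists_list_of_mem_closure hb
  apply Submodule.subset_span
  obtain ⟨l, rfl⟩ : ∃ l', List.map (e q) l' = l := by
    simpa using (Set.range_list_map (e q)).ge (fun x hx => by simpa using hl x hx)
  obtain ⟨k, w, rfl⟩ := Word.exists_toList l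
  exact ⟨k, w, (wordProd_eq_prod _ w).symm⟩

/-- Additive statements can be checked on multiples of monomials. -/
theorem BX.induction {q : YDCocycle n R} {p : BX q → Prop}
    (hadd : ∀ x y, p x → p y → p (x + y))
    (h : ∀ (r : R) {k : ℕ} (w : Word n k), p (r • wordProd (e q) w)) (b : BX q) : p b := by
  have hb : b ∈ Submodule.span R {b | ∃ (k : ℕ) (w : Word n k), b = wordProd (e q) w} :=
    span_wordProd q ▸ Submodule.mem_top
  have h0 : p 0 := by simpa using h 0 .nil
  induction hb using Submodule.closure_induction with
  | zero => exact h0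
  | add x y _ _ hx hy => exact hadd x y hx hy
  | smul_mem r x hx => obtain ⟨k, w, rfl⟩ := hx; exact h r w

theorem degree_eq_span (q : YDCocycle n R) (g : Additive (Equiv.Perm (Fin n))) :
    degree q g = Submodule.span R {b | ∃ (k : ℕ) (w : Word n k),
      wordProd Subtype.val w = g.toMul ∧ b = wordProd (e q) w} := by
  rw [degree]
  congr 1
  ext b
  constructor
  · rintro ⟨l, hl, rfl⟩
    obtain ⟨k, w, rfl⟩ := Word.exists_toList l
    exact ⟨k, w, by rw [wordProd_eq_prod, hl], (wordProd_eq_prod _ w).symm⟩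
  · rintro ⟨k, w, hw, rfl⟩
    exact ⟨w.toList, by rw [← wordProd_eq_prod, hw], wordProd_eq_prod _ w⟩

theorem wordProd_mem_degree (q : YDCocycle n R) {k : ℕ} (w : Word n k) :
    wordProd (e q) w ∈ degree q (Additive.ofMul (wordProd Subtype.val w)) := by
  rw [degree_eq_span]
  exact Submodule.subset_span ⟨k, w, rfl, rfl⟩

theorem e_mem_degree (q : YDCocycle n R) (τ : Transposition n) :
    e q τ ∈ degree q (Additive.ofMul τ.1) := by
  simpa [wordProd] using wordProd_mem_degree q (Word.nil.snoc τ)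

instance (q : YDCocycle n R) : SetLike.GradedMonoid (degree q) where
  one_mem := Submodule.subset_span ⟨[], rfl, rfl⟩
  mul_mem := by
    intro i j a b ha hb
    have h : degree q i * degree q j ≤ degree q (i + j) := by
      rw [degree, degree, Submodule.span_mul_span, Submodule.span_le]
      rintro _ ⟨_, ⟨l, hl, rfl⟩, _, ⟨l', hl', rfl⟩, rfl⟩
      exact Submodule.subset_span ⟨l ++ l', by rw [List.map_append, List.prod_append, hl, hl', toMul_add],
        by rw [List.map_append, List.prod_append]⟩
    exact h (Submodule.mul_mem_mul ha hb)

theorem compatible_id (q : YDCocycle n R) :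
    Compatible (RingHom.id R) (fun _ _ => 1) q q := fun _ _ _ => rfl

theorem weight_const_one {k : ℕ} (w : Word n k) :
    weight (fun _ _ => (1 : R)) 1 w = 1 := by
  induction w with
  | nil => rfl
  | snoc w τ ih => rw [weight_one_snoc, ih, mul_one]

open DirectSum in
/-- The homogeneous generators. -/
def homogeneousGenerator (q : YDCocycle n R) (τ : Transposition n) : ⨁ i, degree q i :=
  DirectSum.of (fun i => degree q i) (Additive.ofMul τ.1) ⟨e q τ, e_mem_degree q τ⟩

theorem wordProd_homogeneousGenerator (q : YDCocycle n R) {k : ℕ} (w : Word n k) :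
    wordProd (homogeneousGenerator q) w =
      DirectSum.of (fun i => degree q i) (Additive.ofMul (wordProd Subtype.val w))
        ⟨wordProd (e q) w, wordProd_mem_degree q w⟩ := by
  induction w with
  | nil => rfl
  | snoc w τ ih =>
    rw [wordProd, ih, homogeneousGenerator, DirectSum.of_mul_of]
    rfl

/-- With `κ = 1` and `ψ` the indicator of `g`, rescaling is the projection onto words with product
`g`. It commutes with the braided factorial, so each homogeneous component of a relation is again a
relation. -/
theorem satisfies_homogeneousGenerator (q : YDCocycle n R) :
    Satisfies q (homogeneousGenerator q) := by
  intro k y hy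
  refine DFinsupp.ext fun g => Subtype.ext ?_
  have h := rescale_wordFactorial (compatible_id q)
    (fun g' => if Additive.ofMul g' = g then 1 else 0) k y
  rw [hy, map_zero] at h
  refine Eq.trans ?_ (satisfies_e q _ h.symm)
  clear h hy
  induction y using Finsupp.induction_linear with
  | zero => simp only [map_zero]; rfl
  | add x y hx hy => rw [map_add, map_add, map_add, ← hx, ← hy]; rfl
  | single w r =>
    rw [rescale_single, weight_eq, Finsupp.linearCombination_single,
      Finsupp.linearCombination_single, weight_const_one, wordProd_homogeneousGenerator]
    by_cases hg : Additive.ofMul (wordProd Subtype.val w) = g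
    · subst hg
      rw [DirectSum.smul_apply, DirectSum.of_eq_same]
      simp
    · rw [DirectSum.smul_apply, DirectSum.of_eq_of_ne _ _ _ (Ne.symm hg)]
      simp [hg]

/-- The `S_n`-grading of `𝓑(X_n, q)`. -/
instance gradedAlgebraBX (q : YDCocycle n R) : GradedAlgebra (degree q) := by
  refine GradedAlgebra.ofAlgHom (degree q)
    (liftBX (homogeneousGenerator q) (satisfies_homogeneousGenerator q)) ?_ ?_
  · refine AlgHom.ext_of_adjoin_eq_top (adjoin_range_e q) ?_
    rintro _ ⟨τ, rfl⟩
    simp [liftBX_e, homogeneousGenerator]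
  · rintro i ⟨x, hx'⟩
    have hx := hx'
    rw [degree_eq_span] at hx
    induction hx using Submodule.span_induction with
    | zero => exact (map_zero _).trans (map_zero (DirectSum.of (fun i => degree q i) i)).symm
    | add x y hx hy ihx ihy =>
      rw [← degree_eq_span] at hx hy
      refine (map_add _ x y).trans ?_
      exact (congrArg₂ (· + ·) (ihx hx) (ihy hy)).trans
        (map_add (DirectSum.of (fun i => degree q i) i) ⟨x, hx⟩ ⟨y, hy⟩).symm
    | smul r x hx ih =>
      rw [← degree_eq_span] at hx
      refine (map_smul _ r x).trans ?_
      exact (congrArg (r • ·) (ih hx)).trans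
        (map_smul (DirectSum.lof R _ (fun i => degree q i) i) r ⟨x, hx⟩).symm
    | mem x hx =>
      obtain ⟨k, w, hw, rfl⟩ := hx
      obtain rfl : Additive.ofMul (wordProd Subtype.val w) = i := by rw [hw]; rfl
      refine Eq.trans ?_ (wordProd_homogeneousGenerator q w)
      simp only [map_wordProd, liftBX_e]

end Universal

/-! ## Cocycle twists of `𝓑(X_n, q)` -/

section Twists

variable {n : ℕ} {K : Type*} [CommRing K]

/-- Change of scalars of `q`. -/
def YDCocycle.map {K' : Type*} [CommRing K'] (h : K →+* K') (q : YDCocycle n K) :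
    YDCocycle n K' where
  toFun σ τ := Units.map (h : K →* K') (q σ τ)
  cocycle ρ σ τ := by rw [q.cocycle, map_mul]

theorem compatible_map {K' : Type*} [CommRing K'] (h : K →+* K') {q : YDCocycle n K}
    {q' : YDCocycle n K'} (hq : ∀ (τ υ : Transposition n), h (q τ.1 υ) = q' τ.1 υ) :
    Compatible h (fun _ _ => 1) q q' := fun _ τ υ => by rw [hq]

/-- `q'` is obtained from `q` by twisting with `ν` and rescaling the basis by `c`. -/
def TwistRel (q q' : YDCocycle n K) (ν : TwoCocycle (Equiv.Perm (Fin n)) Kˣ)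
    (c : Transposition n → Kˣ) : Prop :=
  ∀ τ υ : Transposition n, q τ.1 υ * (ν τ.1 υ.1 * c υ) =
    q' τ.1 υ * (ν (conj τ.1 υ).1 τ.1 * c (conj τ.1 υ))

/-- The rescaling of words belonging to a cocycle and a rescaling of the basis. -/
def twistWeight (ν : TwoCocycle (Equiv.Perm (Fin n)) Kˣ) (c : Transposition n → Kˣ) :
    Equiv.Perm (Fin n) → Transposition n → K :=
  fun g τ => ((ν g τ.1 * c τ : Kˣ) : K)

/-- Since `(τυτ⁻¹) τ = τυ`, the cocycle identity extracts the common factor `ν(g, τυ)` from both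
sides. The dependence on `g` disappears and `TwistRel` is left. -/
theorem TwistRel.compatible {q q' : YDCocycle n K} {ν : TwoCocycle (Equiv.Perm (Fin n)) Kˣ}
    {c : Transposition n → Kˣ} (h : TwistRel q q' ν c) :
    Compatible (RingHom.id K) (twistWeight ν c) q' q := by
  intro g τ υ
  have h1 := ν.cocycle g τ.1 υ.1
  have h2 := ν.cocycle g (conj τ.1 υ).1 τ.1
  have h3 : (conj τ.1 υ).1 * τ.1 = τ.1 * υ.1 := by simp [conj]
  rw [h3] at h2
  have h4 := h τ υ
  simp only [twistWeight, RingHom.id_apply, ← Units.val_mul]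
  congr 1
  calc q τ.1 υ * (ν g τ.1 * c τ * (ν (g * τ.1) υ.1 * c υ))
      = (ν g τ.1 * ν (g * τ.1) υ.1) * c τ * (q τ.1 υ * c υ) := by
        simp only [mul_comm, mul_left_comm, mul_assoc]
    _ = ν g (τ.1 * υ.1) * c τ * (q τ.1 υ * (ν τ.1 υ.1 * c υ)) := by
        rw [h1]; simp only [mul_comm, mul_left_comm, mul_assoc]
    _ = (ν g (τ.1 * υ.1) * ν (conj τ.1 υ).1 τ.1) * c τ * (q' τ.1 υ * c (conj τ.1 υ)) := by
        rw [h4]; simp only [mul_comm, mul_left_comm, mul_assoc]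
    _ = _ := by rw [← h2]; simp only [mul_comm, mul_left_comm, mul_assoc]

/-- The inverse cocycle. -/
def TwoCocycle.inverse {G Γ : Type*} [Group G] [CommGroup Γ] (ν : TwoCocycle G Γ) :
    TwoCocycle G Γ := ν.map invMonoidHom

theorem TwistRel.inverse {q q' : YDCocycle n K} {ν : TwoCocycle (Equiv.Perm (Fin n)) Kˣ}
    {c : Transposition n → Kˣ} (h : TwistRel q q' ν c) :
    TwistRel q' q ν.inverse (fun τ => (c τ)⁻¹) := by
  intro τ υ
  have h4 := h τ υ
  change q' τ.1 υ * ((ν τ.1 υ.1)⁻¹ * (c υ)⁻¹) =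
    q τ.1 υ * ((ν (conj τ.1 υ).1 τ.1)⁻¹ * (c (conj τ.1 υ))⁻¹)
  rw [← mul_inv, ← mul_inv, ← div_eq_mul_inv, ← div_eq_mul_inv, div_eq_div_iff_mul_eq_mul, h4]

theorem weight_inverse (ν : TwoCocycle (Equiv.Perm (Fin n)) Kˣ) (c : Transposition n → Kˣ)
    {k : ℕ} (w : Word n k) :
    weight (twistWeight ν c) 1 w * weight (twistWeight ν.inverse fun τ => (c τ)⁻¹) 1 w = 1 := by
  induction w with
  | nil => exact mul_one 1
  | snoc w τ ih =>
    rw [weight_one_snoc, weight_one_snoc, mul_mul_mul_comm, ih, mul_one, twistWeight, twistWeight,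
      ← Units.val_mul, Units.val_eq_one]
    change ν _ τ.1 * c τ * ((ν _ τ.1)⁻¹ * (c τ)⁻¹) = 1
    rw [← mul_inv, mul_inv_cancel]

theorem weight_inverse' (ν : TwoCocycle (Equiv.Perm (Fin n)) Kˣ) (c : Transposition n → Kˣ)
    {k : ℕ} (w : Word n k) :
    weight (twistWeight ν.inverse fun τ => (c τ)⁻¹) 1 w * weight (twistWeight ν c) 1 w = 1 := by
  rw [mul_comm, weight_inverse]

variable {A : Type*} [Ring A] [Algebra K A] (𝒜 : Additive (Equiv.Perm (Fin n)) → Submodule K A)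
  [GradedAlgebra 𝒜] {a : Transposition n → A}

theorem wordProd_mem (ha : ∀ τ, a τ ∈ 𝒜 (Additive.ofMul τ.1)) {k : ℕ} (w : Word n k) :
    wordProd a w ∈ 𝒜 (Additive.ofMul (wordProd Subtype.val w)) := by
  induction w with
  | nil => exact SetLike.GradedOne.one_mem (A := 𝒜)
  | snoc w τ ih => exact SetLike.GradedMul.mul_mem (A := 𝒜) ih (ha τ)

/-- Multiplying a further letter `τ` onto a monomial of degree `g` contributes `ν(g, τ) c_τ`, which
is the factor that `twistWeight` adds to the weight. -/
theorem wordProd_twist (ν : TwoCocycle (Equiv.Perm (Fin n)) Kˣ) (c : Transposition n → Kˣ)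
    (ha : ∀ τ, a τ ∈ 𝒜 (Additive.ofMul τ.1)) {k : ℕ} (w : Word n k) :
    wordProd (fun τ => CocycleTwist.of 𝒜 ν ((c τ : K) • a τ)) w =
      weight (twistWeight ν c) 1 w • CocycleTwist.of 𝒜 ν (wordProd a w) := by
  induction w with
  | nil => exact (one_smul K (CocycleTwist.of 𝒜 ν 1)).symm
  | snoc w τ ih =>
    rw [wordProd, ih, map_smul, smul_mul_smul_comm,
      CocycleTwist.of_mul_of 𝒜 ν (wordProd_mem 𝒜 ha w) (ha τ), smul_smul, weight_one_snoc]
    congr 1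
    rw [twistWeight, Units.val_mul]
    ring

/-- The relations of a twist. -/
theorem Satisfies.twist {q q' : YDCocycle n K} {ν : TwoCocycle (Equiv.Perm (Fin n)) Kˣ}
    {c : Transposition n → Kˣ} (h : TwistRel q q' ν c) (hs : Satisfies q a)
    (ha : ∀ τ, a τ ∈ 𝒜 (Additive.ofMul τ.1)) :
    Satisfies q' (fun τ => CocycleTwist.of 𝒜 ν ((c τ : K) • a τ)) := by
  intro k y hy
  have h1 := rescale_wordFactorial h.compatible 1 k y
  rw [hy, map_zero] at h1
  have h2 := congrArg (CocycleTwist.of 𝒜 ν) (hs _ h1.symm)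
  rw [map_zero] at h2
  rw [← h2]
  clear h1 h2 hy
  induction y using Finsupp.induction_linear with
  | zero => simp only [map_zero]
  | add x y hx hy => simp only [map_add, hx, hy]
  | single w r =>
    rw [rescale_single, Finsupp.linearCombination_single, Finsupp.linearCombination_single,
      wordProd_twist 𝒜 ν c ha, map_smul, smul_smul, RingHom.id_apply, mul_comm]

/-- Extending the coefficients of a word combination commutes with the braided factorial, so every
relation over `K` becomes a relation over `L`. -/
theorem Satisfies.restrictScalars {L : Type*} [CommRing L] [Algebra K L] {B : Type*} [Semiring B]
    [Algebra K B] [Algebra L B] [IsScalarTower K L B] {q : YDCocycle n K}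
    {b : Transposition n → B} (h : Satisfies (q.map (algebraMap K L)) b) : Satisfies q b := by
  intro k y hy
  have h1 := rescale_wordFactorial
    (compatible_map (algebraMap K L) (q' := q.map (algebraMap K L)) fun _ _ => rfl) 1 k y
  rw [hy, map_zero] at h1
  rw [← h _ h1.symm]
  clear h1 hy
  induction y using Finsupp.induction_linear with
  | zero => simp only [map_zero]
  | add x y hx hy => simp only [map_add, hx, hy]
  | single w r =>
    rw [rescale_single, Finsupp.linearCombination_single, Finsupp.linearCombination_single,
      weight_const_one, one_mul, algebraMap_smul]

end Twists

/-! ## The algebra `ℂC₂` -/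

section GroupAlgebra

/-- The homomorphism from `C₂` with `z ↦ ζ`, where `ζ² = 1`. -/
def character {M : Type*} [Monoid M] (ζ : M) (hζ : ζ * ζ = 1) : C₂ →* M where
  toFun c := if c = 1 then 1 else ζ
  map_one' := if_pos rfl
  map_mul' := by
    have h : ∀ a b : C₂, (a = 1 ∧ b = 1 ∧ a * b = 1) ∨ (a = 1 ∧ b ≠ 1 ∧ a * b ≠ 1) ∨
        (a ≠ 1 ∧ b = 1 ∧ a * b ≠ 1) ∨ (a ≠ 1 ∧ b ≠ 1 ∧ a * b = 1) := by decide
    intro a b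
    rcases h a b with ⟨h1, h2, h3⟩ | ⟨h1, h2, h3⟩ | ⟨h1, h2, h3⟩ | ⟨h1, h2, h3⟩ <;>
    simp [h1, h2, h3, hζ]

/-- The evaluation `ℂC₂ → ℂ`, `z ↦ ζ`. -/
def eval (ζ : ℂ) (hζ : ζ * ζ = 1) : ℂC₂ →ₐ[ℂ] ℂ :=
  MonoidAlgebra.lift ℂ ℂ C₂ (character ζ hζ)

variable (ζ : ℂ) (hζ : ζ * ζ = 1)

theorem eval_z : eval ζ hζ (z : ℂC₂) = ζ := by
  have : (z : ℂC₂) = MonoidAlgebra.of ℂ C₂ z₀ := rfl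
  rw [this, eval, MonoidAlgebra.lift_of]
  change (if z₀ = 1 then (1 : ℂ) else ζ) = ζ
  exact if_neg (by decide)

theorem eval_idem_self : eval ζ hζ (idem ζ) = 1 := by
  rw [idem, map_smul, map_add, map_smul, eval_z, map_one, smul_eq_mul, smul_eq_mul, hζ]
  norm_num

theorem eval_idem_neg : eval ζ hζ (idem (-ζ)) = 0 := by
  rw [idem, map_smul, map_add, map_smul, eval_z, map_one, smul_eq_mul, smul_eq_mul, neg_mul, hζ]
  norm_num

theorem idem_add_idem_neg : idem ζ + idem (-ζ) = 1 := by
  rw [idem, idem, ← smul_add, neg_smul, add_add_add_comm, add_neg_cancel, add_zero, ← two_smul ℂ,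
    smul_smul]
  norm_num

theorem z_mul_idem (hζ : ζ * ζ = 1) : (z : ℂC₂) * idem ζ = ζ • idem ζ := by
  have hz : (z : ℂC₂) * z = 1 := by rw [← Units.val_mul, z_mul_z, Units.val_one]
  rw [idem, mul_smul_comm, smul_comm ζ, mul_add, mul_one, mul_smul_comm, hz, smul_add ζ,
    smul_smul, hζ, one_smul, add_comm]

theorem mul_idem (hζ : ζ * ζ = 1) (r : ℂC₂) : r * idem ζ = eval ζ hζ r • idem ζ := by
  induction r using MonoidAlgebra.induction_on with
  | of c =>
    have hc : ∀ c : C₂, c = 1 ∨ c = z₀ := by decide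
    rcases hc c with rfl | rfl
    · rw [map_one, one_mul, map_one, one_smul]
    · have : MonoidAlgebra.of ℂ C₂ z₀ = (z : ℂC₂) := rfl
      rw [this, z_mul_idem ζ hζ, eval_z]
  | add x y hx hy => rw [add_mul, hx, hy, map_add, add_smul]
  | smul r x hx => rw [smul_mul_assoc, hx, map_smul, smul_assoc]

/-- This is the isomorphism `ℂC₂ ≅ ℂ × ℂ` in coordinates; later vanishing arguments check the two
values separately. -/
theorem eq_eval_smul_idem_add (r : ℂC₂) (hζ' : -ζ * -ζ = 1) :
    r = eval ζ hζ r • idem ζ + eval (-ζ) hζ' r • idem (-ζ) := by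
  rw [← mul_idem, ← mul_idem (-ζ), ← mul_add, idem_add_idem_neg, mul_one]

end GroupAlgebra

/-! ## Cocycle extensions -/

section Extensions

variable {n : ℕ}

/-- A relation over `ℂC₂` specialises at `z = 1` and `z = -1` to relations over `ℂ`, because the
values of `q` are constants. The idempotents reassemble the original combination from these two. -/
theorem satisfies_baseChange (q : YDCocycle n ℂ) :
    Satisfies (q.map (algebraMap ℂ ℂC₂)) (fun τ => (1 : ℂC₂) ⊗ₜ[ℂ] e q τ) := by
  intro k y hy
  have key (ζ : ℂ) (hζ : ζ * ζ = 1) :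
      Finsupp.linearCombination ℂ (wordProd (e q))
        (rescale (eval ζ hζ).toRingHom (fun _ _ => 1) 1 k y) = 0 := by
    refine satisfies_e q _ ?_
    rw [← rescale_wordFactorial (q := q.map (algebraMap ℂ ℂC₂))
      (compatible_map _ fun τ υ => (eval ζ hζ).commutes _), hy, map_zero]
  have hsum : Finsupp.linearCombination ℂC₂ (wordProd fun τ => (1 : ℂC₂) ⊗ₜ[ℂ] e q τ) y =
      idem 1 ⊗ₜ[ℂ] Finsupp.linearCombination ℂ (wordProd (e q))
        (rescale (eval 1 (one_mul 1)).toRingHom (fun _ _ => 1) 1 k y) +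
      idem (-1) ⊗ₜ[ℂ] Finsupp.linearCombination ℂ (wordProd (e q))
        (rescale (eval (-1) (by norm_num)).toRingHom (fun _ _ => 1) 1 k y) := by
    clear key hy
    induction y using Finsupp.induction_linear with
    | zero => simp only [map_zero, TensorProduct.tmul_zero, add_zero]
    | add x y hx hy =>
      simp only [map_add, TensorProduct.tmul_add, hx, hy]
      abel
    | single w r =>
      have hw := map_wordProd (Algebra.TensorProduct.includeRight (R := ℂ) (A := ℂC₂) (B := BX q))
        (e q) w
      simp only [Algebra.TensorProduct.includeRight_apply] at hw
      simp only [rescale_single, Finsupp.linearCombination_single, weight_const_one, one_mul,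
        AlgHom.toRingHom_eq_coe, RingHom.coe_coe]
      rw [← hw, TensorProduct.smul_tmul', smul_eq_mul, mul_one, TensorProduct.tmul_smul,
        TensorProduct.tmul_smul, TensorProduct.smul_tmul', TensorProduct.smul_tmul',
        ← TensorProduct.add_tmul, ← eq_eval_smul_idem_add]
  rw [hsum, key, key, TensorProduct.tmul_zero, TensorProduct.tmul_zero, add_zero]

/-- The linear map `ℂC₂ ⊗ 𝓑(X_n, q) → 𝓑(ℂC₂X_n, q')` which rescales monomials by a twist. -/
theorem exists_linearMap_of_twistRel {q : YDCocycle n ℂ} {q' : YDCocycle n ℂC₂}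
    {ν : TwoCocycle (Equiv.Perm (Fin n)) ℂC₂ˣ} {c : Transposition n → ℂC₂ˣ}
    (h : TwistRel q' (q.map (algebraMap ℂ ℂC₂)) ν c) :
    ∃ G : ℂC₂ ⊗[ℂ] BX q →ₗ[ℂC₂] BX q', ∀ {k : ℕ} (w : Word n k),
      G (1 ⊗ₜ wordProd (e q) w) = weight (twistWeight ν c) 1 w • wordProd (e q') w := by
  let _ : Algebra ℂ (CocycleTwist (degree q') ν) :=
    Algebra.compHom _ (algebraMap ℂ ℂC₂)
  have : IsScalarTower ℂ ℂC₂ (CocycleTwist (degree q') ν) :=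
    IsScalarTower.of_algebraMap_eq fun _ => rfl
  -- The universal property gives an algebra map into the twist of `𝓑(ℂC₂X_n, q')`. Forgetting the
  -- twist leaves a linear map that rescales monomials.
  have hs := ((satisfies_e q').twist (degree q') h (e_mem_degree q')).restrictScalars (K := ℂ)
  refine ⟨(CocycleTwist.of (degree q') ν).symm.toLinearMap ∘ₗ
    (liftBX _ hs).toLinearMap.liftBaseChange ℂC₂, fun w => ?_⟩
  rw [LinearMap.comp_apply, LinearMap.liftBaseChange_tmul, one_smul, AlgHom.toLinearMap_apply,
    map_wordProd]
  simp only [liftBX_e]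
  rw [wordProd_twist (degree q') ν c (e_mem_degree q'), LinearEquiv.coe_coe, map_smul,
    LinearEquiv.symm_apply_apply]

theorem tmul_smul_eq_smul {M : Type*} [AddCommMonoid M] [Module ℂ M] (s : ℂC₂) (r : ℂ) (a : M) :
    s ⊗ₜ[ℂ] (r • a) = (r • s) • ((1 : ℂC₂) ⊗ₜ[ℂ] a) := by
  rw [TensorProduct.smul_tmul' (r • s), smul_eq_mul, mul_one, TensorProduct.smul_tmul]

/-- Additive statements on a cocycle extension can be checked on multiples of monomials. -/
theorem CocycleExtension.induction {q : YDCocycle n ℂ}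
    {ν : TwoCocycle (Equiv.Perm (Fin n)) ℂC₂ˣ} {p : CocycleExtension (degree q) ν → Prop}
    (hadd : ∀ x y, p x → p y → p (x + y))
    (h : ∀ (r : ℂC₂) {k : ℕ} (w : Word n k), p (r •
      CocycleTwist.of (fun g => (degree q g).baseChange ℂC₂) ν (1 ⊗ₜ wordProd (e q) w)))
    (x : CocycleExtension (degree q) ν) : p x := by
  have key (y : ℂC₂ ⊗[ℂ] BX q) :
      p (CocycleTwist.of (fun g => (degree q g).baseChange ℂC₂) ν y) := by
    induction y using TensorProduct.induction_on with
    | zero =>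
      rw [LinearEquiv.map_zero, ← zero_smul ℂC₂]
      exact h 0 .nil
    | add x y hx hy =>
      rw [LinearEquiv.map_add]
      exact hadd _ _ hx hy
    | tmul s b =>
      induction b using BX.induction with
      | hadd x y hx hy =>
        rw [TensorProduct.tmul_add, LinearEquiv.map_add]
        exact hadd _ _ hx hy
      | h r w =>
        rw [tmul_smul_eq_smul, LinearEquiv.map_smul]
        exact h _ w
  exact key ((CocycleTwist.of (fun g => (degree q g).baseChange ℂC₂) ν).symm x)

set_option maxHeartbeats 1000000 in
/-- If `q'` is a twist of `q` then `𝓑(ℂC₂X_n, q')` is a cocycle extension of `𝓑(X_n, q)`. -/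
theorem exists_algEquiv_cocycleExtension {q : YDCocycle n ℂ} {q' : YDCocycle n ℂC₂}
    {ν : TwoCocycle (Equiv.Perm (Fin n)) ℂC₂ˣ} {c : Transposition n → ℂC₂ˣ}
    (h : TwistRel (q.map (algebraMap ℂ ℂC₂)) q' ν c) :
    ∃ F : BX q' ≃ₐ[ℂC₂] CocycleExtension (degree q) ν,
      ∀ {k : ℕ} (w : Word n k), F (wordProd (e q') w) = weight (twistWeight ν c) 1 w •
        CocycleTwist.of (fun g => (degree q g).baseChange ℂC₂) ν (1 ⊗ₜ wordProd (e q) w) := by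
  have hmem (τ : Transposition n) :
      (1 : ℂC₂) ⊗ₜ[ℂ] e q τ ∈ (degree q (Additive.ofMul τ.1)).baseChange ℂC₂ :=
    Submodule.tmul_mem_baseChange_of_mem _ (e_mem_degree q τ)
  have hs := (satisfies_baseChange q).twist (fun g => (degree q g).baseChange ℂC₂) h hmem
  -- The inverse only has to be linear: bijectivity is tested on monomials, where the weights of the
  -- two mutually inverse twists cancel.
  obtain ⟨G, hG⟩ := exists_linearMap_of_twistRel h.inverse
  have hF {k : ℕ} (w : Word n k) : liftBX _ hs (wordProd (e q') w) =
      weight (twistWeight ν c) 1 w •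
        CocycleTwist.of (fun g => (degree q g).baseChange ℂC₂) ν (1 ⊗ₜ wordProd (e q) w) := by
    have hw := map_wordProd (Algebra.TensorProduct.includeRight (R := ℂ) (A := ℂC₂) (B := BX q))
      (e q) w
    simp only [Algebra.TensorProduct.includeRight_apply] at hw
    rw [map_wordProd]
    simp only [liftBX_e]
    rw [wordProd_twist (fun g => (degree q g).baseChange ℂC₂) ν c hmem, hw]
  obtain ⟨G', hG'⟩ : ∃ G' : CocycleExtension (degree q) ν →ₗ[ℂC₂] BX q',
      ∀ {k : ℕ} (w : Word n k),
        G' (CocycleTwist.of (fun g => (degree q g).baseChange ℂC₂) ν (1 ⊗ₜ wordProd (e q) w)) =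
          weight (twistWeight ν.inverse fun τ => (c τ)⁻¹) 1 w • wordProd (e q') w :=
    ⟨G ∘ₗ (CocycleTwist.of (fun g => (degree q g).baseChange ℂC₂) ν).symm.toLinearMap,
      fun w => hG w⟩
  refine ⟨AlgEquiv.ofBijective (liftBX _ hs)
    (Function.bijective_iff_has_inverse.2 ⟨G', fun b => ?_, fun x => ?_⟩), hF⟩
  · induction b using BX.induction with
    | hadd x y hx hy => rw [map_add, map_add, hx, hy]
    | h r w =>
      rw [map_smul, hF, map_smul, map_smul, hG', smul_smul (weight _ _ _), weight_inverse,
        one_smul]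
  · induction x using CocycleExtension.induction with
    | hadd x y hx hy =>
      rw [LinearMap.map_add, map_add]
      exact congrArg₂ (· + ·) hx hy
    | h r w =>
      rw [LinearMap.map_smul, hG', map_smul, map_smul, hF, smul_smul (weight _ _ _),
        weight_inverse', one_smul]

/-- Twists give graded isomorphisms with cocycle extensions. -/
theorem exists_isExtensionIso {q : YDCocycle n ℂ}
    {ν : TwoCocycle (Equiv.Perm (Fin n)) ℂC₂ˣ} {c : Transposition n → ℂC₂ˣ}
    (h : TwistRel (q.map (algebraMap ℂ ℂC₂)) (qz n) ν c) :
    ∃ F : BX (qz n) ≃ₐ[ℂC₂] CocycleExtension (degree q) ν, IsExtensionIso F c := by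
  obtain ⟨F, hF⟩ := exists_algEquiv_cocycleExtension h
  refine ⟨F, fun τ => ?_, fun g => ?_⟩
  · have h1 := hF (Word.nil.snoc τ)
    simp only [wordProd, one_mul, twistWeight, ν.one_left, weight, Pi.one_apply] at h1
    rw [h1, ← map_smul, TensorProduct.smul_tmul', smul_eq_mul, mul_one]
  -- Weights are units, so rescaled monomials of degree `g` span the same submodule as the monomials
  -- themselves.
  · have hunit {k : ℕ} (w : Word n k) : IsUnit (weight (twistWeight ν c) 1 w) :=
      IsUnit.of_mul_eq_one _ (weight_inverse ν c w)
    have hb : (degree q g).baseChange ℂC₂ = Submodule.span ℂC₂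
        {x | ∃ (k : ℕ) (w : Word n k), wordProd Subtype.val w = g.toMul ∧
          x = (1 : ℂC₂) ⊗ₜ[ℂ] wordProd (e q) w} := by
      rw [degree_eq_span, Submodule.baseChange_span]
      congr 1
      ext x
      constructor
      · rintro ⟨_, ⟨k, w, hw, rfl⟩, rfl⟩
        exact ⟨k, w, hw, rfl⟩
      · rintro ⟨k, w, hw, rfl⟩
        exact ⟨_, ⟨k, w, hw, rfl⟩, rfl⟩
    rw [hb, degree_eq_span, Submodule.map_span, Submodule.map_span]
    apply le_antisymm
    · rw [Submodule.span_le]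
      rintro _ ⟨_, ⟨k, w, hw, rfl⟩, rfl⟩
      refine (hF w).symm ▸ Submodule.smul_mem _ _ (Submodule.subset_span ⟨_, ⟨k, w, hw, rfl⟩, rfl⟩)
    · rw [Submodule.span_le]
      rintro _ ⟨_, ⟨k, w, hw, rfl⟩, rfl⟩
      have hm : F (wordProd (e (qz n)) w) ∈ Submodule.span ℂC₂ (F.toLinearMap ''
          {b | ∃ (k : ℕ) (w : Word n k), wordProd Subtype.val w = g.toMul ∧
            b = wordProd (e (qz n)) w}) :=
        Submodule.subset_span ⟨_, ⟨k, w, hw, rfl⟩, rfl⟩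
      rw [hF w] at hm
      exact (Submodule.smul_mem_iff_of_isUnit _ (hunit w)).1 hm

/-- The twist changes only the product, so the module is the extension of scalars of a complex
vector space. -/
theorem free_BX_of_twistRel {q : YDCocycle n ℂ} {q' : YDCocycle n ℂC₂}
    {ν : TwoCocycle (Equiv.Perm (Fin n)) ℂC₂ˣ} {c : Transposition n → ℂC₂ˣ}
    (h : TwistRel (q.map (algebraMap ℂ ℂC₂)) q' ν c) : Module.Free ℂC₂ (BX q') := by
  obtain ⟨F, -⟩ := exists_algEquiv_cocycleExtension h
  exact Module.Free.of_equiv ((F.toLinearEquiv.trans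
    (CocycleTwist.of (fun g => (degree q g).baseChange ℂC₂) ν).symm).symm)

end Extensions

/-! ## Specialisations -/

section Specialisations

variable {n : ℕ} {q : YDCocycle n ℂ} {q' : YDCocycle n ℂC₂} (ζ : ℂ) (hζ : ζ * ζ = 1)

theorem idem_neg_eq (hζ : ζ * ζ = 1) :
    idem (-ζ) = ((z : ℂC₂) - algebraMap ℂ ℂC₂ ζ) * (-(2⁻¹ * ζ) • 1) := by
  rw [idem, mul_smul_comm, mul_one, Algebra.algebraMap_eq_smul_one, smul_sub, smul_smul, smul_add,
    smul_smul, neg_mul (2⁻¹ * ζ), mul_assoc, hζ, mul_one, mul_neg, neg_smul, neg_smul]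
  abel

theorem idem_smul_idem_neg_smul (hζ : ζ * ζ = 1) (b : BX q') : idem ζ • idem (-ζ) • b = 0 := by
  have hζ' : -ζ * -ζ = 1 := by rw [neg_mul_neg, hζ]
  have h := eval_idem_neg (-ζ) hζ'
  rw [neg_neg] at h
  rw [smul_smul, mul_idem (-ζ) hζ', h, zero_smul, zero_smul]

theorem idem_smul_add (b : BX q') : idem ζ • b + idem (-ζ) • b = b := by
  rw [← add_smul, idem_add_idem_neg, one_smul]

theorem rescale_eval_rescale {k : ℕ} (y : Word n k →₀ ℂ) :
    rescale (eval ζ hζ).toRingHom (fun _ _ => 1) 1 k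
      (rescale (algebraMap ℂ ℂC₂) (fun _ _ => 1) 1 k y) = y := by
  induction y using Finsupp.induction_linear with
  | zero => simp only [map_zero]
  | add x y hx hy => simp only [map_add, hx, hy]
  | single w r =>
    simp only [rescale_single, weight_const_one, one_mul]
    exact congrArg _ ((eval ζ hζ).commutes r)

theorem rescale_eval_apply {k : ℕ} (y : Word n k →₀ ℂC₂) (w : Word n k) :
    rescale (eval ζ hζ).toRingHom (fun _ _ => 1) 1 k y w = eval ζ hζ (y w) := by
  induction y using Finsupp.induction_linear with
  | zero => simp only [map_zero, Finsupp.zero_apply]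
  | add x y hx hy => simp only [map_add, Finsupp.add_apply, hx, hy]
  | single w' r =>
    classical
    simp only [rescale_single, weight_const_one, one_mul, Finsupp.single_apply]
    split_ifs
    · rfl
    · exact (map_zero _).symm

theorem linearCombination_rescale_algebraMap {B : Type*} [Ring B] [Algebra ℂ B] [Algebra ℂC₂ B]
    [IsScalarTower ℂ ℂC₂ B] (a : Transposition n → B) {k : ℕ} (y : Word n k →₀ ℂ) :
    Finsupp.linearCombination ℂC₂ (wordProd a)
      (rescale (algebraMap ℂ ℂC₂) (fun _ _ => 1) 1 k y) =
        Finsupp.linearCombination ℂ (wordProd a) y := by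
  induction y using Finsupp.induction_linear with
  | zero => simp only [map_zero]
  | add x y hx hy => simp only [map_add, hx, hy]
  | single w r =>
    rw [rescale_single, Finsupp.linearCombination_single, Finsupp.linearCombination_single,
      weight_const_one, one_mul, algebraMap_smul]

/-- The factorial for `q'` of `idem ζ • y` vanishes coefficientwise: at `z = ζ` it becomes the
factorial for `q` of `y`, and at `z = -ζ` the idempotent is zero. -/
theorem idem_smul_linearCombination_eq_zero
    (hq : ∀ τ υ : Transposition n, eval ζ hζ (q' τ.1 υ) = q τ.1 υ) {k : ℕ} (y : Word n k →₀ ℂ)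
    (hy : wordFactorial q k y = 0) :
    idem ζ • Finsupp.linearCombination ℂ (wordProd (e q')) y = 0 := by
  have hζ' : -ζ * -ζ = 1 := by rw [neg_mul_neg, hζ]
  rw [← linearCombination_rescale_algebraMap, ← map_smul]
  refine satisfies_e q' _ (Finsupp.ext fun w => ?_)
  have h1 : eval ζ hζ (wordFactorial q' k
      (idem ζ • rescale (algebraMap ℂ ℂC₂) (fun _ _ => 1) 1 k y) w) = 0 := by
    rw [← rescale_eval_apply, rescale_wordFactorial (compatible_map _ hq), rescale_smul,
      rescale_eval_rescale, map_smul, hy, smul_zero, Finsupp.zero_apply]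
  have h2 : eval (-ζ) hζ' (wordFactorial q' k
      (idem ζ • rescale (algebraMap ℂ ℂC₂) (fun _ _ => 1) 1 k y) w) = 0 := by
    have h := eval_idem_neg (-ζ) hζ'
    rw [neg_neg] at h
    rw [map_smul, Finsupp.smul_apply, smul_eq_mul, map_mul, h, zero_mul]
  rw [eq_eval_smul_idem_add ζ hζ (wordFactorial _ _ _ _) hζ', h1, h2, zero_smul, zero_smul,
    add_zero, Finsupp.zero_apply]

/-- The two-sided ideal of elements killed by `(1 + ζ z)/2`. -/
def idemKernel (q' : YDCocycle n ℂC₂) : Ideal (BX q') where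
  carrier := {b | idem ζ • b = 0}
  zero_mem' := smul_zero _
  add_mem' := fun {a b} ha hb => by
    simp only [Set.mem_ofPred_eq] at *
    rw [smul_add, ha, hb, add_zero]
  smul_mem' := fun c b hb => by
    simp only [Set.mem_ofPred_eq, smul_eq_mul] at *
    rw [← mul_smul_comm, hb, mul_zero]

instance : (idemKernel ζ q').IsTwoSided where
  mul_mem_of_left {a} b ha := by
    change idem ζ • (a * b) = 0
    rw [← smul_mul_assoc, show idem ζ • a = 0 from ha, zero_mul]

/-- This provides a map from `𝓑(X_n, q)` back to a quotient of `𝓑(ℂC₂X_n, q')`, from which the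
kernel of the evaluation is read off. -/
theorem satisfies_idemKernel_mk
    (hq : ∀ τ υ : Transposition n, eval ζ hζ (q' τ.1 υ) = q τ.1 υ) :
    Satisfies q (fun τ => Ideal.Quotient.mkₐ ℂ (idemKernel ζ q') (e q' τ)) := by
  intro k y hy
  have h : Ideal.Quotient.mkₐ ℂ (idemKernel ζ q')
      (Finsupp.linearCombination ℂ (wordProd (e q')) y) = 0 :=
    Ideal.Quotient.eq_zero_iff_mem.2 (idem_smul_linearCombination_eq_zero ζ hζ hq y hy)
  rw [← h, ← AlgHom.coe_toLinearMap, Finsupp.apply_linearCombination]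
  congr 2
  funext w
  exact (map_wordProd (Ideal.Quotient.mkₐ ℂ (idemKernel ζ q')) _ w).symm

/-- The evaluation at `z = ζ`. -/
theorem exists_evaluation (hq : ∀ τ υ : Transposition n, eval ζ hζ (q' τ.1 υ) = q τ.1 υ) :
    ∃ Φ : BX q' →ₐ[ℂ] BX q, (∀ τ, Φ (e q' τ) = e q τ) ∧
      ∀ r b, Φ (r • b) = eval ζ hζ r • Φ b := by
  -- Letting `z` act as `ζ` makes `𝓑(X_n, q)` a `ℂC₂`-algebra to which the universal property over
  -- `ℂC₂` applies.
  let _ : Algebra ℂC₂ (BX q) := Algebra.compHom _ (eval ζ hζ).toRingHom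
  have hsm (r : ℂC₂) (b : BX q) : r • b = eval ζ hζ r • b := rfl
  have : IsScalarTower ℂ ℂC₂ (BX q) := ⟨fun x r b => by
    rw [hsm, hsm, map_smul, smul_assoc]⟩
  have hs : Satisfies q' (e q) := by
    intro k y hy
    have h := rescale_wordFactorial (compatible_map (eval ζ hζ).toRingHom hq) 1 k y
    rw [hy, map_zero] at h
    rw [← satisfies_e q _ h.symm]
    clear h hy
    induction y using Finsupp.induction_linear with
    | zero => simp only [map_zero]
    | add x y hx hy => simp only [map_add, hx, hy]
    | single w r =>
      rw [rescale_single, Finsupp.linearCombination_single, Finsupp.linearCombination_single,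
        weight_const_one, one_mul, hsm]
      rfl
  exact ⟨(liftBX _ hs).restrictScalars ℂ, liftBX_e _ hs, fun r b => map_smul (liftBX _ hs) r b⟩

variable {ζ hζ}

section Evaluation

variable {Φ : BX q' →ₐ[ℂ] BX q}

theorem evaluation_surjective (he : ∀ τ, Φ (e q' τ) = e q τ) : Function.Surjective Φ := by
  intro b
  induction b using BX.induction with
  | hadd x y hx hy =>
    obtain ⟨x, rfl⟩ := hx
    obtain ⟨y, rfl⟩ := hy
    exact ⟨x + y, map_add Φ x y⟩
  | h r w =>
    refine ⟨r • wordProd (e q') w, ?_⟩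
    rw [map_smul, map_wordProd]
    simp only [he]

/-- Evaluation followed by the map back is the projection modulo the annihilator of `idem ζ`: they
agree on monomials, and `r` and its value at `ζ` act alike after multiplication by `idem ζ`. Hence
the kernel lies in the annihilator. -/
theorem evaluation_eq_zero_iff (he : ∀ τ, Φ (e q' τ) = e q τ)
    (hr : ∀ r b, Φ (r • b) = eval ζ hζ r • Φ b)
    (hq : ∀ τ υ : Transposition n, eval ζ hζ (q' τ.1 υ) = q τ.1 υ) (b : BX q') :
    Φ b = 0 ↔ idem ζ • b = 0 := by
  constructor
  · intro hb
    have key (b : BX q') : liftBX _ (satisfies_idemKernel_mk ζ hζ hq) (Φ b) =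
        Ideal.Quotient.mkₐ ℂ (idemKernel ζ q') b := by
      induction b using BX.induction with
      | hadd x y hx hy => rw [map_add, map_add, map_add, hx, hy]
      | h r w =>
        rw [hr, map_smul, map_wordProd, map_wordProd]
        simp only [he, liftBX_e]
        rw [← map_wordProd, ← map_smul]
        refine Ideal.Quotient.eq.2 ?_
        change idem ζ • (_ - _) = 0
        rw [smul_sub, smul_smul, mul_comm, mul_idem ζ hζ, smul_comm, smul_assoc, sub_self]
    have h := key b
    rw [hb, map_zero] at h
    exact Ideal.Quotient.eq_zero_iff_mem.1 h.symm
  · intro hb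
    have h := hr (idem ζ) b
    rwa [hb, map_zero, eval_idem_self, one_smul, eq_comm] at h

/-- An element killed by `idem ζ` equals `idem (-ζ)` times itself, and `idem (-ζ)` is a multiple of
`z - ζ`. So the kernel of the evaluation is exactly what the specialisation divides out. -/
theorem exists_specialisation_algEquiv (he : ∀ τ, Φ (e q' τ) = e q τ)
    (hr : ∀ r b, Φ (r • b) = eval ζ hζ r • Φ b)
    (hq : ∀ τ υ : Transposition n, eval ζ hζ (q' τ.1 υ) = q τ.1 υ) :
    ∃ S : Specialisation (BX q') (z : ℂC₂) ζ ≃ₐ[ℂ] BX q,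
      ∀ τ, S (RingQuot.mkAlgHom ℂ _ (e q' τ)) = e q τ := by
  have hrel : ∀ ⦃a b : BX q'⦄, (∃ c : BX q', a = ((z : ℂC₂) - algebraMap ℂ ℂC₂ ζ) • c ∧ b = 0) →
      Φ a = Φ b := by
    rintro _ _ ⟨c, rfl, rfl⟩
    rw [hr, map_sub, eval_z, AlgHom.commutes, map_zero, Algebra.algebraMap_self_apply, sub_self,
      zero_smul]
  have hlift (b : BX q') : RingQuot.liftAlgHom ℂ ⟨Φ, hrel⟩ (RingQuot.mkAlgHom ℂ _ b) = Φ b :=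
    RingQuot.liftAlgHom_mkAlgHom_apply ℂ Φ hrel b
  refine ⟨AlgEquiv.ofBijective (RingQuot.liftAlgHom ℂ ⟨Φ, hrel⟩) ⟨?_, ?_⟩, fun τ => ?_⟩
  · rw [injective_iff_map_eq_zero]
    intro x hx
    obtain ⟨b, rfl⟩ := RingQuot.mkAlgHom_surjective ℂ _ x
    rw [hlift, evaluation_eq_zero_iff he hr hq] at hx
    have hb := idem_smul_add ζ b
    rw [hx, zero_add, idem_neg_eq ζ hζ, mul_smul] at hb
    have h := RingQuot.mkAlgHom_rel ℂ
      (s := fun a b : BX q' => ∃ c : BX q', a = ((z : ℂC₂) - algebraMap ℂ ℂC₂ ζ) • c ∧ b = 0)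
      ⟨_, hb.symm, rfl⟩
    rw [h, map_zero]
  · intro x
    obtain ⟨b, rfl⟩ := evaluation_surjective he x
    exact ⟨_, hlift b⟩
  · exact (hlift _).trans (he τ)

end Evaluation

/-- The ideal generated by an idempotent `(1 + ζ z)/2` is killed by the complementary one. -/
theorem mem_idealPart_iff {ζ : ℂ} (hζ : ζ * ζ = 1) (b : BX (qz n)) :
    b ∈ idealPart n ζ ↔ idem (-ζ) • b = 0 := by
  constructor
  · intro hb
    have hζ' : -ζ * -ζ = 1 := by rw [neg_mul_neg, hζ]
    have hle : idealPart n ζ ≤ (idemKernel (-ζ) (qz n)).toTwoSided := by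
      rw [idealPart, TwoSidedIdeal.span_le, Set.singleton_subset_iff]
      have h := idem_smul_idem_neg_smul (q' := qz n) (-ζ) hζ' 1
      rw [neg_neg] at h
      rw [SetLike.mem_coe, Ideal.mem_toTwoSided, Algebra.algebraMap_eq_smul_one]
      exact h
    exact Ideal.mem_toTwoSided.1 (hle hb)
  · intro hb
    have h := idem_smul_add ζ b
    rw [hb, add_zero, Algebra.smul_def] at h
    rw [← h]
    exact TwoSidedIdeal.mul_mem_right _ _ _ (TwoSidedIdeal.subset_span rfl)

theorem isCompl_idealPart {ζ : ℂ} (hζ : ζ * ζ = 1) :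
    IsCompl (idealPart n ζ) (idealPart n (-ζ)) := by
  have hζ' : -ζ * -ζ = 1 := by rw [neg_mul_neg, hζ]
  constructor
  · rw [disjoint_iff_inf_le]
    intro b hb
    obtain ⟨h1, h2⟩ := (TwoSidedIdeal.mem_inf _).1 hb
    rw [mem_idealPart_iff hζ] at h1
    rw [mem_idealPart_iff hζ', neg_neg] at h2
    rw [TwoSidedIdeal.mem_bot, ← idem_smul_add ζ b, h1, h2, add_zero]
  · rw [codisjoint_iff_le_sup]
    intro b _
    rw [← idem_smul_add ζ b]
    refine add_mem (le_sup_left (a := idealPart n ζ) ?_)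
      (le_sup_right (b := idealPart n (-ζ)) ?_)
    · rw [mem_idealPart_iff hζ]
      simpa using idem_smul_idem_neg_smul (-ζ) hζ' b
    · rw [mem_idealPart_iff hζ', neg_neg]
      exact idem_smul_idem_neg_smul ζ hζ b

end Specialisations

/-! ## The double cover of `S_n` with class `[1, z]` -/

section DoubleCover

/-- Here `decomposeFin.symm (p, σ)` is `(0 p)` times the extension of `σ` fixing `0`, so `p` labels
a coset of the stabiliser of `0`. This lemma and the next three describe left multiplication by
transpositions in these coordinates, as needed for the induction in `exists_hom_of_swaps`. -/
theorem swap_succ_mul_decomposeFin_symm {m : ℕ} (a b : Fin m) (p : Fin (m + 1))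
    (σ : Equiv.Perm (Fin m)) :
    Equiv.swap a.succ b.succ * Equiv.Perm.decomposeFin.symm (p, σ) =
      Equiv.Perm.decomposeFin.symm (Equiv.swap a.succ b.succ p, Equiv.swap a b * σ) := by
  have h0 : Equiv.swap a.succ b.succ 0 = 0 :=
    Equiv.swap_apply_of_ne_of_ne (Fin.succ_ne_zero a).symm (Fin.succ_ne_zero b).symm
  ext x : 1
  refine Fin.cases ?_ (fun x => ?_) x
  · simp
  · rw [Equiv.Perm.mul_apply, Equiv.Perm.decomposeFin_symm_apply_succ,
      Equiv.Perm.decomposeFin_symm_apply_succ, ← Equiv.Perm.mul_apply, Equiv.mul_swap_eq_swap_mul,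
      Equiv.Perm.mul_apply, h0, (Fin.succ_injective m).swap_apply, Equiv.Perm.mul_apply]

theorem swap_zero_mul_decomposeFin_symm_zero {m : ℕ} (b : Fin m) (σ : Equiv.Perm (Fin m)) :
    Equiv.swap 0 b.succ * Equiv.Perm.decomposeFin.symm (0, σ) =
      Equiv.Perm.decomposeFin.symm (b.succ, σ) := by
  ext x : 1
  refine Fin.cases ?_ (fun x => ?_) x <;> simp

theorem swap_zero_mul_decomposeFin_symm_self {m : ℕ} (b : Fin m) (σ : Equiv.Perm (Fin m)) :
    Equiv.swap 0 b.succ * Equiv.Perm.decomposeFin.symm (b.succ, σ) =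
      Equiv.Perm.decomposeFin.symm (0, σ) := by
  rw [← swap_zero_mul_decomposeFin_symm_zero, ← mul_assoc, Equiv.swap_mul_self, one_mul]

/-- The identity behind this is `(0 b)(0 c) = (0 c)(c b)`: the coset stays the same and a
transposition fixing `0` acts on `σ`. -/
theorem swap_zero_mul_decomposeFin_symm_of_ne {m : ℕ} {b c : Fin m} (hbc : b ≠ c)
    (σ : Equiv.Perm (Fin m)) :
    Equiv.swap 0 b.succ * Equiv.Perm.decomposeFin.symm (c.succ, σ) =
      Equiv.Perm.decomposeFin.symm (c.succ, Equiv.swap c b * σ) := by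
  have hbc' : b.succ ≠ c.succ := fun h => hbc (Fin.succ_injective m h)
  have h1 : Equiv.swap (0 : Fin (m + 1)) c.succ b.succ = b.succ :=
    Equiv.swap_apply_of_ne_of_ne (Fin.succ_ne_zero b) hbc'
  rw [← swap_zero_mul_decomposeFin_symm_zero c, ← swap_zero_mul_decomposeFin_symm_zero c,
    ← mul_assoc]
  have h2 : Equiv.Perm.decomposeFin.symm (0, Equiv.swap c b * σ) =
      Equiv.swap c.succ b.succ * Equiv.Perm.decomposeFin.symm (0, σ) := by
    rw [swap_succ_mul_decomposeFin_symm, Equiv.swap_apply_of_ne_of_ne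
      (Fin.succ_ne_zero c).symm (Fin.succ_ne_zero b).symm]
  rw [h2, ← mul_assoc, Equiv.mul_swap_eq_swap_mul (Equiv.swap 0 c.succ), Equiv.swap_apply_right,
    h1]

/-- The symmetric group is presented by its transpositions, with the relations `t² = 1` and the
conjugation relations. -/
theorem exists_hom_of_swaps {M : Type*} [Group M] {m : ℕ} (t : Fin m → Fin m → M)
    (hsymm : ∀ i j, t i j = t j i) (hsq : ∀ i j, t i j * t i j = 1)
    (hconj : ∀ i j k l, i ≠ j → k ≠ l →
      t i j * t k l = t (Equiv.swap i j k) (Equiv.swap i j l) * t i j) :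
    ∃ f : Equiv.Perm (Fin m) →* M, ∀ i j, i ≠ j → f (Equiv.swap i j) = t i j := by
  -- Compatibility with left multiplication by transpositions implies multiplicativity, because they
  -- generate, and it can be checked coset by coset.
  suffices h : ∃ f : Equiv.Perm (Fin m) → M, f 1 = 1 ∧
      ∀ i j, i ≠ j → ∀ σ, f (Equiv.swap i j * σ) = t i j * f σ by
    obtain ⟨f, h1, hf⟩ := h
    refine ⟨⟨⟨f, h1⟩, fun σ ρ => ?_⟩, fun i j hij => ?_⟩
    · change f (σ * ρ) = f σ * f ρ
      induction σ using Equiv.Perm.swap_induction_on with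
      | one => rw [h1, one_mul, one_mul]
      | swap_mul σ i j hij ih => rw [mul_assoc, hf _ _ hij, ih, hf _ _ hij, mul_assoc]
    · have := hf i j hij 1
      rwa [mul_one, h1, mul_one] at this
  induction m with
  | zero => exact ⟨fun _ => 1, rfl, fun i => i.elim0⟩
  | succ m ih =>
    obtain ⟨f, h1, hf⟩ := ih (fun i j => t i.succ j.succ) (fun i j => hsymm _ _)
      (fun i j => hsq _ _) (fun i j k l hij hkl => by
        rw [hconj _ _ _ _ (fun h => hij (Fin.succ_injective m h))
          (fun h => hkl (Fin.succ_injective m h)), (Fin.succ_injective m).swap_apply,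
          (Fin.succ_injective m).swap_apply])
    -- `T p` is the image of the coset representative `(0 p)`, hence `1` for `p = 0`; the map `f` on
    -- the stabiliser of `0` comes from the induction hypothesis.
    let T : Fin (m + 1) → M := fun p => if p = 0 then 1 else t 0 p
    have hT (b : Fin m) : T b.succ = t 0 b.succ := if_neg (Fin.succ_ne_zero b)
    have hT0 : T 0 = 1 := if_pos rfl
    let F : Equiv.Perm (Fin (m + 1)) → M := fun σ =>
      T (Equiv.Perm.decomposeFin σ).1 * f (Equiv.Perm.decomposeFin σ).2
    have hF (p : Fin (m + 1)) (σ : Equiv.Perm (Fin m)) :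
        F (Equiv.Perm.decomposeFin.symm (p, σ)) = T p * f σ := by
      simp only [F, Equiv.apply_symm_apply]
    have hzero (b : Fin m) (σ : Equiv.Perm (Fin (m + 1))) :
        F (Equiv.swap 0 b.succ * σ) = t 0 b.succ * F σ := by
      obtain ⟨⟨p, σ⟩, rfl⟩ := Equiv.Perm.decomposeFin.symm.surjective σ
      refine Fin.cases ?_ (fun c => ?_) p
      · rw [swap_zero_mul_decomposeFin_symm_zero, hF, hF, hT, hT0, one_mul]
      · by_cases hbc : b = c
        · subst hbc
          rw [swap_zero_mul_decomposeFin_symm_self, hF, hF, hT, hT0, ← mul_assoc, hsq]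
        · rw [swap_zero_mul_decomposeFin_symm_of_ne hbc, hF, hF, hf _ _ (Ne.symm hbc), hT,
            ← mul_assoc, ← mul_assoc, hsymm c.succ b.succ]
          have h := hconj 0 c.succ b.succ c.succ (Fin.succ_ne_zero c).symm
            (fun h => hbc (Fin.succ_injective m h))
          rw [Equiv.swap_apply_right, Equiv.swap_apply_of_ne_of_ne (Fin.succ_ne_zero b)
            (fun h => hbc (Fin.succ_injective m h)), hsymm b.succ 0] at h
          rw [h]
    refine ⟨F, ?_, fun i j hij => ?_⟩
    · have h : Equiv.Perm.decomposeFin.symm (0, (1 : Equiv.Perm (Fin m))) = 1 := by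
        ext x : 1
        refine Fin.cases ?_ (fun x => ?_) x <;> simp
      rw [← h, hF, h1, hT0, one_mul]
    · induction i using Fin.cases with
      | zero =>
        induction j using Fin.cases with
        | zero => exact absurd rfl hij
        | succ b => exact hzero b
      | succ a =>
        induction j using Fin.cases with
        | zero => rw [Equiv.swap_comm, hsymm]; exact hzero a
        | succ b =>
          intro σ
          obtain ⟨⟨p, σ⟩, rfl⟩ := Equiv.Perm.decomposeFin.symm.surjective σ
          have hab : a ≠ b := fun h => hij (congrArg Fin.succ h)
          have h0 : Equiv.swap a.succ b.succ 0 = 0 :=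
            Equiv.swap_apply_of_ne_of_ne (Fin.succ_ne_zero a).symm (Fin.succ_ne_zero b).symm
          rw [swap_succ_mul_decomposeFin_symm, hF, hF, hf a b hab, ← mul_assoc, ← mul_assoc]
          congr 1
          refine Fin.cases ?_ (fun c => ?_) p
          · rw [h0, hT0, one_mul, mul_one]
          · have h := hconj a.succ b.succ 0 c.succ hij (Fin.succ_ne_zero c).symm
            rw [h0, (Fin.succ_injective m).swap_apply] at h
            rw [(Fin.succ_injective m).swap_apply, hT, hT, h]

/-! ### Roots in a Clifford algebra -/

/-- Half the sum of squares on `ℚ^n`; the roots `e_i - e_j` have norm `1`. -/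
abbrev rootForm (n : ℕ) : QuadraticForm ℚ (Fin n → ℚ) :=
  QuadraticMap.weightedSumSquares ℚ (fun _ : Fin n => (2⁻¹ : ℚ))

/-- The root `e_i - e_j`. -/
def root {n : ℕ} (i j : Fin n) : Fin n → ℚ := Pi.single i 1 - Pi.single j 1

theorem rootForm_root {n : ℕ} {i j : Fin n} (hij : i ≠ j) : rootForm n (root i j) = 1 := by
  have h (x : Fin n) : root i j x * root i j x =
      (if x = i then 1 else 0) + if x = j then 1 else 0 := by
    simp only [root, Pi.sub_apply, Pi.single_apply]
    split_ifs <;> simp_all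
  rw [QuadraticMap.weightedSumSquares_apply, ← Finset.smul_sum]
  simp only [h, Finset.sum_add_distrib]
  norm_num

theorem polar_rootForm_root {n : ℕ} (i j : Fin n) (v : Fin n → ℚ) :
    QuadraticMap.polar (rootForm n) (root i j) v = v i - v j := by
  have h (x : Fin n) : (2⁻¹ : ℚ) • ((root i j + v) x * (root i j + v) x) -
      (2⁻¹ : ℚ) • (root i j x * root i j x) - (2⁻¹ : ℚ) • (v x * v x) = root i j x * v x := by
    simp only [Pi.add_apply, smul_eq_mul]
    ring
  rw [QuadraticMap.polar]
  simp only [QuadraticMap.weightedSumSquares_apply]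
  rw [← Finset.sum_sub_distrib, ← Finset.sum_sub_distrib]
  simp only [h]
  simp only [root, Pi.sub_apply, sub_mul, Finset.sum_sub_distrib, Pi.single_apply, ite_mul,
    one_mul, zero_mul, Finset.sum_ite_eq', Finset.mem_univ, if_true]

theorem comp_swap_eq {n : ℕ} (i j : Fin n) (v : Fin n → ℚ) (x : Fin n) :
    v (Equiv.swap i j x) = v x - (v i - v j) * root i j x := by
  simp only [root, Pi.sub_apply, Pi.single_apply, Equiv.swap_apply_def]
  split_ifs <;> simp_all

/-- The transposition `(i j)` permutes coordinates as the reflection in `e_i - e_j`. By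
`polar_rootForm_root`, the coefficient is the polar form of the two roots. -/
theorem root_swap {n : ℕ} (i j k l : Fin n) :
    root (Equiv.swap i j k) (Equiv.swap i j l) = root k l - (root k l i - root k l j) • root i j := by
  have h1 (k x : Fin n) : (Pi.single (Equiv.swap i j k) 1 : Fin n → ℚ) x =
      (Pi.single k 1 : Fin n → ℚ) (Equiv.swap i j x) := by
    simp only [Pi.single_apply, Equiv.swap_apply_eq_iff]
  funext x
  rw [Pi.sub_apply, Pi.smul_apply, smul_eq_mul, ← comp_swap_eq]
  simp only [root, Pi.sub_apply, h1]

/-- The generators of the double cover, as units of the Clifford algebra. -/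
def cliffordRoot {n : ℕ} (i j : Fin n) : (CliffordAlgebra (rootForm n))ˣ :=
  -- The root vanishes for `i = j`; the value `1` is a unit with square `1`, as
  -- `exists_hom_of_swaps` requires of all pairs.
  if h : i = j then 1 else
    { val := CliffordAlgebra.ι _ (root i j)
      inv := CliffordAlgebra.ι _ (root i j)
      val_inv := by rw [CliffordAlgebra.ι_sq_scalar, rootForm_root h, map_one]
      inv_val := by rw [CliffordAlgebra.ι_sq_scalar, rootForm_root h, map_one] }

theorem coe_cliffordRoot {n : ℕ} {i j : Fin n} (h : i ≠ j) :
    (cliffordRoot i j : CliffordAlgebra (rootForm n)) = CliffordAlgebra.ι _ (root i j) := by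
  rw [cliffordRoot, dif_neg h]

theorem cliffordRoot_mul_self {n : ℕ} (i j : Fin n) : cliffordRoot i j * cliffordRoot i j = 1 := by
  by_cases h : i = j
  · rw [cliffordRoot, dif_pos h, mul_one]
  · rw [Units.ext_iff, Units.val_mul, coe_cliffordRoot h, CliffordAlgebra.ι_sq_scalar,
      rootForm_root h, map_one, Units.val_one]

theorem cliffordRoot_comm {n : ℕ} {i j : Fin n} (h : i ≠ j) :
    cliffordRoot j i = -cliffordRoot i j := by
  rw [Units.ext_iff, Units.val_neg, coe_cliffordRoot h, coe_cliffordRoot h.symm, ← map_neg]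
  congr 1
  exact (neg_sub _ _).symm

/-- For a unit vector `α`, the Clifford relation gives `αβ = (α, β) - βα = -(β - (α, β)α)α`, and the
bracket is the reflection of `β`. -/
theorem cliffordRoot_mul {n : ℕ} {i j k l : Fin n} (hij : i ≠ j) (hkl : k ≠ l) :
    cliffordRoot i j * cliffordRoot k l =
      -(cliffordRoot (Equiv.swap i j k) (Equiv.swap i j l) * cliffordRoot i j) := by
  have hkl' : Equiv.swap i j k ≠ Equiv.swap i j l := fun h => hkl ((Equiv.swap i j).injective h)
  rw [Units.ext_iff, Units.val_neg, Units.val_mul, Units.val_mul, coe_cliffordRoot hij,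
    coe_cliffordRoot hkl, coe_cliffordRoot hkl', root_swap, ← polar_rootForm_root, map_sub,
    map_smul, sub_mul, smul_mul_assoc, CliffordAlgebra.ι_sq_scalar, rootForm_root hij, map_one,
    ← Algebra.algebraMap_eq_smul_one, neg_sub, ← CliffordAlgebra.ι_mul_ι_add_swap,
    add_sub_cancel_right]

end DoubleCover

section DoubleCoverCocycle

variable {n : ℕ}

theorem C₂.eq_one_or (c : C₂) : c = 1 ∨ c = z₀ := by
  revert c
  decide

theorem C₂.mul_self (c : C₂) : c * c = 1 := by
  revert c
  decide

open Classical in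
/-- The value of `q_z / q_1` at a pair of transpositions. -/
def twistSign (τ υ : Transposition n) : C₂ := if Inverts τ.1 υ then 1 else z₀

/-- A section of a central extension by `C₂` gives a cocycle. -/
theorem exists_cocycle_of_section {G M : Type*} [Group G] [Group M] (χ : C₂ →* M)
    (hinj : Function.Injective χ) (hcomm : ∀ c m, χ c * m = m * χ c) (x : G → M) (h1 : x 1 = 1)
    (h : ∀ g g', ∃ c, x g * x g' = χ c * x (g * g')) :
    ∃ μ : TwoCocycle G C₂, ∀ g g', x g * x g' = χ (μ g g') * x (g * g') := by
  choose μ hμ using h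
  refine ⟨⟨μ, fun g g' k => hinj ?_, fun g => hinj ?_, fun g => hinj ?_⟩, hμ⟩
  · rw [map_mul, map_mul]
    apply mul_right_cancel (b := x (g * g' * k))
    calc χ (μ g g') * χ (μ (g * g') k) * x (g * g' * k) = x g * x g' * x k := by
          rw [mul_assoc, ← hμ, ← mul_assoc, ← hμ]
      _ = χ (μ g (g' * k)) * χ (μ g' k) * x (g * g' * k) := by
          rw [mul_assoc, hμ g' k, ← mul_assoc, ← hcomm, mul_assoc, hμ g, ← mul_assoc, ← map_mul,
            mul_comm (μ g' k), map_mul, mul_assoc g]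
  · have := hμ 1 g
    rw [h1, one_mul, one_mul] at this
    rw [map_one]
    exact right_eq_mul.1 this
  · have := hμ g 1
    rw [h1, mul_one, mul_one] at this
    rw [map_one]
    exact right_eq_mul.1 this

/-! ### Simple transpositions -/

theorem simple_isSwap {i : ℕ} (hi : i + 1 < n) : (simple i hi).IsSwap :=
  ⟨_, _, by simp, rfl⟩

/-- A simple transposition, as an element of `X_n`. -/
def simpleX (i : ℕ) (hi : i + 1 < n) : Transposition n := ⟨simple i hi, simple_isSwap hi⟩

theorem simple_val {i : ℕ} (hi : i + 1 < n) (x : Fin n) :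
    ((simple i hi x : Fin n) : ℕ) = if x.1 = i then i + 1 else if x.1 = i + 1 then i else x.1 := by
  simp only [simple, Equiv.swap_apply_def, Fin.ext_iff]
  split_ifs <;> rfl

theorem simple_mul_self {i : ℕ} (hi : i + 1 < n) : simple i hi * simple i hi = 1 :=
  Equiv.swap_mul_self _ _

theorem simple_inv {i : ℕ} (hi : i + 1 < n) : (simple i hi)⁻¹ = simple i hi :=
  Equiv.swap_inv _ _

theorem simple_injective {k k' : ℕ} {hk : k + 1 < n} {hk' : k' + 1 < n}
    (h : simple k hk = simple k' hk') : k = k' := by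
  have h1 := congrArg Fin.val (DFunLike.congr_fun h ⟨k, by omega⟩)
  rw [simple_val, simple_val] at h1
  dsimp only at h1
  split_ifs at h1 <;> omega

/-- Together with the next lemma: `l + 1` is the largest point moved by `s_k s_l`, so the product
determines `l`. -/
theorem simple_mul_simple_apply_lt {k l : ℕ} (hk : k + 1 < n) (hl : l + 1 < n) (hkl : k < l) :
    (((simple k hk * simple l hl) ⟨l + 1, hl⟩ : Fin n) : ℕ) < l + 1 := by
  have h : ((simple l hl ⟨l + 1, hl⟩ : Fin n) : ℕ) = l := by
    rw [simple_val, if_neg (Nat.succ_ne_self l), if_pos rfl]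
  rw [Equiv.Perm.mul_apply, simple_val, h]
  split_ifs <;> omega

theorem simple_mul_simple_apply_of_gt {k l : ℕ} (hk : k + 1 < n) (hl : l + 1 < n) (hkl : k < l)
    {x : Fin n} (hx : l + 1 < x) : (((simple k hk * simple l hl) x : Fin n) : ℕ) = x := by
  have h : ((simple l hl x : Fin n) : ℕ) = x := by
    rw [simple_val, if_neg (by omega), if_neg (by omega)]
  rw [Equiv.Perm.mul_apply, simple_val, h, if_neg (by omega), if_neg (by omega)]

theorem simple_mul_simple_injective {k l k' l' : ℕ} {hk : k + 1 < n} {hl : l + 1 < n}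
    {hk' : k' + 1 < n} {hl' : l' + 1 < n} (hkl : k < l) (hkl' : k' < l')
    (h : simple k hk * simple l hl = simple k' hk' * simple l' hl') : k = k' ∧ l = l' := by
  have hll : l = l' := by
    rcases lt_trichotomy l l' with hlt | heq | hlt
    · have h1 := simple_mul_simple_apply_lt hk' hl' hkl'
      rw [← h, simple_mul_simple_apply_of_gt hk hl hkl (Nat.succ_lt_succ hlt)] at h1
      exact absurd h1 (lt_irrefl _)
    · exact heq
    · have h1 := simple_mul_simple_apply_lt hk hl hkl
      rw [h, simple_mul_simple_apply_of_gt hk' hl' hkl' (Nat.succ_lt_succ hlt)] at h1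
      exact absurd h1 (lt_irrefl _)
  subst hll
  exact ⟨simple_injective (mul_right_cancel h), rfl⟩

/-- The left side sends `k` to `k + 2`, whereas `s_{k'} s_{l'}` with `k' < l'` raises no point by
more than one. -/
theorem simple_succ_mul_simple_ne {k k' l' : ℕ} {hk : k + 1 < n} {hl : k + 1 + 1 < n}
    {hk' : k' + 1 < n} {hl' : l' + 1 < n} (hkl' : k' < l') :
    simple (k + 1) hl * simple k hk ≠ simple k' hk' * simple l' hl' := by
  intro h
  have h1 := congrArg Fin.val (DFunLike.congr_fun h ⟨k, by omega⟩)
  have h2 : ((simple k hk ⟨k, by omega⟩ : Fin n) : ℕ) = k + 1 := by rw [simple_val, if_pos rfl]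
  rw [Equiv.Perm.mul_apply, simple_val, h2, if_pos rfl, Equiv.Perm.mul_apply, simple_val] at h1
  have h3 := simple_val hl' ⟨k, by omega⟩
  dsimp only at h3
  split_ifs at h1 h3 <;> omega

theorem simple_commute {k l : ℕ} (hk : k + 1 < n) (hl : l + 1 < n) (hkl : k + 1 < l) :
    simple l hl * simple k hk = simple k hk * simple l hl := by
  ext x
  simp only [Equiv.Perm.mul_apply, simple_val]
  split_ifs <;> omega

theorem simple_mul_simple_not_isSwap {k l : ℕ} (hk : k + 1 < n) (hl : l + 1 < n) :
    ¬ (simple k hk * simple l hl).IsSwap := fun h => by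
  have h1 := h.sign_eq
  rw [Equiv.Perm.sign_mul, (simple_isSwap hk).sign_eq, (simple_isSwap hl).sign_eq] at h1
  exact absurd h1 (by decide)

theorem simple_mul_simple_ne_one {k l : ℕ} {hk : k + 1 < n} {hl : l + 1 < n} (hkl : k ≠ l) :
    simple k hk * simple l hl ≠ 1 := fun h =>
  hkl (simple_injective ((mul_eq_one_iff_eq_inv.1 h).trans (simple_inv hl)))

theorem not_isSwap_one : ¬ (1 : Equiv.Perm (Fin n)).IsSwap := fun h => by
  have h1 := h.sign_eq
  rw [Equiv.Perm.sign_one] at h1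
  exact absurd h1 (by decide)

theorem inverts_simpleX_iff {i : ℕ} (hi : i + 1 < n) (σ : Equiv.Perm (Fin n)) :
    Inverts σ (simpleX i hi) ↔ σ ⟨i + 1, hi⟩ < σ ⟨i, Nat.lt_of_succ_lt hi⟩ :=
  inverts_iff σ _ (Fin.mk_lt_mk.2 (Nat.lt_succ_self i)) rfl

theorem inverts_simpleX_simpleX {k l : ℕ} (hk : k + 1 < n) (hl : l + 1 < n) (hkl : k + 1 < l) :
    ¬ Inverts (simple l hl) (simpleX k hk) ∧ ¬ Inverts (simple k hk) (simpleX l hl) := by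
  rw [inverts_simpleX_iff, inverts_simpleX_iff, Fin.lt_def, Fin.lt_def]
  simp only [simple_val]
  split_ifs <;> omega

theorem conj_simpleX_of_lt {k l : ℕ} (hk : k + 1 < n) (hl : l + 1 < n) (hkl : k + 1 < l) :
    conj (simple l hl) (simpleX k hk) = simpleX k hk :=
  Subtype.ext (by
    change simple l hl * simple k hk * (simple l hl)⁻¹ = simple k hk
    rw [simple_commute hk hl hkl, mul_inv_cancel_right])

/-! ### The lift of the transpositions -/

/-- The lift of a transposition to the Clifford algebra. -/
def cliffordLift (τ : Transposition n) : (CliffordAlgebra (rootForm n))ˣ :=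
  cliffordRoot (exists_lt_swap τ).choose (exists_lt_swap τ).choose_spec.choose

theorem cliffordLift_eq (τ : Transposition n) {i j : Fin n} (hij : i < j)
    (h : τ.1 = Equiv.swap i j) : cliffordLift τ = cliffordRoot i j := by
  obtain ⟨h1, h2⟩ := (exists_lt_swap τ).choose_spec.choose_spec
  obtain ⟨h3, h4⟩ := swap_eq_of_lt hij h1 (h.symm.trans h2)
  exact congrArg₂ cliffordRoot h3.symm h4.symm

/-- The embedding of `C₂` in the Clifford algebra. -/
def cliffordSign (n : ℕ) : C₂ →* (CliffordAlgebra (rootForm n))ˣ :=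
  character (-1) (by rw [neg_mul_neg, one_mul])

theorem cliffordSign_z₀ : cliffordSign n z₀ = -1 := by
  change (if z₀ = 1 then (1 : (CliffordAlgebra (rootForm n))ˣ) else -1) = -1
  exact if_neg (by decide)

theorem cliffordSign_comm (c : C₂) (m : (CliffordAlgebra (rootForm n))ˣ) :
    cliffordSign n c * m = m * cliffordSign n c := by
  rcases C₂.eq_one_or c with rfl | rfl
  · rw [map_one, one_mul, mul_one]
  · rw [cliffordSign_z₀, neg_one_mul, mul_neg_one]

theorem cliffordSign_injective : Function.Injective (cliffordSign n) := by
  rw [injective_iff_map_eq_one]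
  intro c hc
  rcases C₂.eq_one_or c with rfl | rfl
  · rfl
  · exfalso
    rw [cliffordSign_z₀, Units.ext_iff, Units.val_neg, Units.val_one] at hc
    have h2 : (2 : ℚ) • (1 : CliffordAlgebra (rootForm n)) = 0 := by
      rw [two_smul]
      nth_rewrite 1 [← hc]
      exact neg_add_cancel 1
    exact one_ne_zero ((smul_eq_zero_iff_right (two_ne_zero (α := ℚ))).1 h2)

/-- The reflection contributes `-1`. If `τ` inverts `υ`, the reflected root is the negative of the
one chosen to lift `τυτ⁻¹`, and the two signs cancel. -/
theorem cliffordLift_mul (τ υ : Transposition n) :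
    cliffordLift τ * cliffordLift υ =
      cliffordSign n (twistSign τ υ) * (cliffordLift (conj τ.1 υ) * cliffordLift τ) := by
  obtain ⟨i, j, hij, hτ⟩ := exists_lt_swap τ
  obtain ⟨k, l, hkl, hυ⟩ := exists_lt_swap υ
  have hc : (conj τ.1 υ).1 = Equiv.swap (τ.1 k) (τ.1 l) := by
    simp only [conj, hυ, Equiv.swap_apply_apply]
  have hne : τ.1 k ≠ τ.1 l := fun h => hkl.ne (τ.1.injective h)
  rw [cliffordLift_eq τ hij hτ, cliffordLift_eq υ hkl hυ, cliffordRoot_mul hij.ne hkl.ne, ← hτ,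
    twistSign]
  rcases lt_or_gt_of_ne hne with h | h
  · rw [cliffordLift_eq _ h hc, if_neg (fun hi => h.not_gt ((inverts_iff _ _ hkl hυ).1 hi)),
      cliffordSign_z₀, neg_one_mul]
  · rw [cliffordLift_eq _ h (hc.trans (Equiv.swap_comm _ _)),
      if_pos ((inverts_iff _ _ hkl hυ).2 h), map_one, one_mul, cliffordRoot_comm h.ne, neg_mul,
      neg_neg]

theorem cliffordLift_mul_self (τ : Transposition n) : cliffordLift τ * cliffordLift τ = 1 :=
  cliffordRoot_mul_self _ _

/-- The permutations on which the section of the double cover is prescribed, apart from the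
identity and the transpositions. -/
def Prescribed (g : Equiv.Perm (Fin n)) (m : (CliffordAlgebra (rootForm n))ˣ) : Prop :=
  (∃ (k l : ℕ) (hk : k + 1 < n) (hl : l + 1 < n), k < l ∧ g = simple k hk * simple l hl ∧
    m = cliffordLift (simpleX k hk) * cliffordLift (simpleX l hl)) ∨
  ∃ (k : ℕ) (hk : k + 1 < n) (hl : k + 1 + 1 < n), g = simple (k + 1) hl * simple k hk ∧
    m = -(cliffordLift (simpleX (k + 1) hl) * cliffordLift (simpleX k hk))

/-- The normalisation of `[1, z]` dictates the section on products of two distinct simple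
transpositions, and this says that the demands do not conflict. A reversed product `s_l s_k` with `l
> k + 1` equals `s_k s_l` and receives no value of its own. -/
theorem Prescribed.unique {g : Equiv.Perm (Fin n)} {m m' : (CliffordAlgebra (rootForm n))ˣ}
    (h : Prescribed g m) (h' : Prescribed g m') : m = m' := by
  rcases h with ⟨k, l, hk, hl, hkl, hg, rfl⟩ | ⟨k, hk, hl, hg, rfl⟩ <;>
  rcases h' with ⟨k', l', hk', hl', hkl', hg', rfl⟩ | ⟨k', hk', hl', hg', rfl⟩
  · obtain ⟨rfl, rfl⟩ := simple_mul_simple_injective hkl hkl' (hg.symm.trans hg')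
    rfl
  · exact absurd (hg'.symm.trans hg) (simple_succ_mul_simple_ne hkl)
  · exact absurd (hg.symm.trans hg') (simple_succ_mul_simple_ne hkl')
  · have h := congrArg (·⁻¹) (hg.symm.trans hg')
    simp only [mul_inv_rev, simple_inv] at h
    obtain ⟨rfl, -⟩ := simple_mul_simple_injective (Nat.lt_succ_self k) (Nat.lt_succ_self k') h
    rfl

theorem Prescribed.not_isSwap {g : Equiv.Perm (Fin n)} {m : (CliffordAlgebra (rootForm n))ˣ}
    (h : Prescribed g m) : ¬ g.IsSwap := by
  rcases h with ⟨k, l, hk, hl, -, rfl, -⟩ | ⟨k, hk, hl, rfl, -⟩ <;>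
  exact simple_mul_simple_not_isSwap _ _

theorem Prescribed.ne_one {g : Equiv.Perm (Fin n)} {m : (CliffordAlgebra (rootForm n))ˣ}
    (h : Prescribed g m) : g ≠ 1 := by
  rcases h with ⟨k, l, hk, hl, hkl, rfl, -⟩ | ⟨k, hk, hl, rfl, -⟩
  · exact simple_mul_simple_ne_one hkl.ne
  · exact simple_mul_simple_ne_one (Nat.succ_ne_self k)

/-- Modulo `±1` the signs in the Clifford relations disappear, so the lifts define a homomorphism
from `S_n` to the quotient. Any choice of preimages is then multiplicative up to sign, which leaves
the values on particular permutations free to be prescribed. -/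
theorem exists_section : ∃ x : Equiv.Perm (Fin n) → (CliffordAlgebra (rootForm n))ˣ,
    x 1 = 1 ∧ (∀ τ : Transposition n, x τ.1 = cliffordLift τ) ∧
    (∀ g m, Prescribed g m → x g = m) ∧
    ∀ g g', ∃ c, x g * x g' = cliffordSign n c * x (g * g') := by
  classical
  have hnormal : (cliffordSign n).range.Normal := ⟨by
    rintro _ ⟨c, rfl⟩ m
    exact ⟨c, by rw [← cliffordSign_comm, mul_inv_cancel_right]⟩⟩
  let mk := QuotientGroup.mk' (cliffordSign n).range
  have hneg (m : (CliffordAlgebra (rootForm n))ˣ) : mk (-m) = mk m := by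
    have h : m⁻¹ * -m ∈ (cliffordSign n).range :=
      ⟨z₀, by rw [cliffordSign_z₀, mul_neg, inv_mul_cancel]⟩
    exact (QuotientGroup.eq.2 h).symm
  obtain ⟨f, hf⟩ := exists_hom_of_swaps (fun i j : Fin n => mk (cliffordRoot i j))
    (fun i j => by
      by_cases h : i = j
      · rw [h]
      · rw [cliffordRoot_comm h, hneg])
    (fun i j => by rw [← map_mul, cliffordRoot_mul_self, map_one])
    (fun i j k l hij hkl => by rw [← map_mul, cliffordRoot_mul hij hkl, hneg, map_mul])
  have hfτ (τ : Transposition n) : f τ.1 = mk (cliffordLift τ) := by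
    obtain ⟨i, j, hij, hτ⟩ := exists_lt_swap τ
    rw [cliffordLift_eq τ hij hτ, hτ, hf i j hij.ne]
  have hfp (g m) (h : Prescribed g m) : f g = mk m := by
    rcases h with ⟨k, l, hk, hl, -, rfl, rfl⟩ | ⟨k, hk, hl, rfl, rfl⟩
    · rw [map_mul, map_mul, ← hfτ, ← hfτ]; rfl
    · rw [hneg, map_mul, map_mul, ← hfτ, ← hfτ]; rfl
  let x : Equiv.Perm (Fin n) → (CliffordAlgebra (rootForm n))ˣ := fun g =>
    if g = 1 then 1 else if h : g.IsSwap then cliffordLift ⟨g, h⟩ else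
      if h : ∃ m, Prescribed g m then h.choose else (QuotientGroup.mk'_surjective _ (f g)).choose
  have hx1 : x 1 = 1 := if_pos rfl
  have hxτ (τ : Transposition n) : x τ.1 = cliffordLift τ := by
    have h1 : τ.1 ≠ 1 := fun h => not_isSwap_one (h ▸ τ.2)
    simp only [x, if_neg h1, dif_pos τ.2]
  have hxp (g m) (h : Prescribed g m) : x g = m := by
    have h' : ∃ m, Prescribed g m := ⟨m, h⟩
    simp only [x, if_neg h.ne_one, dif_neg h.not_isSwap, dif_pos h']
    exact h'.choose_spec.unique h
  have hmk (g) : mk (x g) = f g := by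
    by_cases h1 : g = 1
    · rw [h1, hx1, map_one, map_one]
    by_cases h2 : g.IsSwap
    · rw [hxτ ⟨g, h2⟩, ← hfτ]
    by_cases h3 : ∃ m, Prescribed g m
    · obtain ⟨m, hm⟩ := h3
      rw [hxp g m hm, hfp g m hm]
    · simp only [x, if_neg h1, dif_neg h2, dif_neg h3]
      exact (QuotientGroup.mk'_surjective _ (f g)).choose_spec
  refine ⟨x, hx1, hxτ, hxp, fun g g' => ?_⟩
  have h : mk (x (g * g')) = mk (x g * x g') := by rw [hmk, map_mul, map_mul, hmk, hmk]
  obtain ⟨c, hc⟩ := QuotientGroup.eq.1 h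
  exact ⟨c, by rw [cliffordSign_comm, hc, mul_inv_cancel_left]⟩

/-- A representative of `[1, z]` with the prescribed commutation of transpositions. -/
theorem exists_inClass : ∃ μ : TwoCocycle (Equiv.Perm (Fin n)) C₂, InClass 1 z₀ μ ∧
    ∀ τ υ : Transposition n, μ τ.1 υ.1 = twistSign τ υ * μ (conj τ.1 υ).1 τ.1 := by
  obtain ⟨x, hx1, hxτ, hxp, hx⟩ := exists_section (n := n)
  obtain ⟨μ, hμ⟩ := exists_cocycle_of_section (cliffordSign n) cliffordSign_injective
    cliffordSign_comm x hx1 hx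
  have key (τ υ : Transposition n) :
      μ τ.1 υ.1 = twistSign τ υ * μ (conj τ.1 υ).1 τ.1 := by
    apply cliffordSign_injective (n := n)
    have h1 := hμ τ.1 υ.1
    have h2 := hμ (conj τ.1 υ).1 τ.1
    have h3 : (conj τ.1 υ).1 * τ.1 = τ.1 * υ.1 := by simp [conj]
    rw [hxτ, hxτ, cliffordLift_mul] at h1
    rw [hxτ, hxτ, h3] at h2
    rw [h2, ← mul_assoc, ← map_mul] at h1
    exact (mul_right_cancel h1).symm
  have hlt {k l : ℕ} (hk : k + 1 < n) (hl : l + 1 < n) (hkl : k < l) :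
      μ (simple k hk) (simple l hl) = 1 := by
    apply cliffordSign_injective (n := n)
    have h := hμ (simpleX k hk).1 (simpleX l hl).1
    rw [hxp ((simpleX k hk).1 * (simpleX l hl).1) _ (Or.inl ⟨k, l, hk, hl, hkl, rfl, rfl⟩), hxτ,
      hxτ] at h
    rw [map_one]
    exact right_eq_mul.1 h
  refine ⟨μ, ⟨μ, ⟨fun _ => 1, rfl, fun g h => by simp⟩, fun i hi => ?_, fun k l hk hl hkl =>
    ⟨hlt hk hl hkl, ?_⟩⟩, key⟩
  · apply cliffordSign_injective (n := n)
    have h := hμ (simpleX i hi).1 (simpleX i hi).1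
    have h2 : (simpleX i hi).1 * (simpleX i hi).1 = 1 := simple_mul_self hi
    rw [hxτ, cliffordLift_mul_self, h2, hx1, mul_one] at h
    rw [map_one]
    exact h.symm
  -- The value `z` has two sources: for distant simple transpositions the lifts anticommute, and for
  -- adjacent ones it comes from the minus sign in `Prescribed`.
  · rcases Nat.lt_or_ge (k + 1) l with h | h
    · have h1 := key (simpleX l hl) (simpleX k hk)
      change μ (simple l hl) (simple k hk) = _ * μ (conj (simple l hl) (simpleX k hk)).1 _ at h1
      rw [conj_simpleX_of_lt hk hl h] at h1
      have h2 : twistSign (simpleX l hl) (simpleX k hk) = z₀ :=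
        if_neg (inverts_simpleX_simpleX hk hl h).1
      rw [h1, h2]
      exact (congrArg (z₀ * ·) (hlt hk hl hkl)).trans (mul_one z₀)
    · obtain rfl : l = k + 1 := by omega
      apply cliffordSign_injective (n := n)
      have h1 := hμ (simpleX (k + 1) hl).1 (simpleX k hk).1
      rw [hxp ((simpleX (k + 1) hl).1 * (simpleX k hk).1) _ (Or.inr ⟨k, hk, hl, rfl, rfl⟩), hxτ,
        hxτ, mul_neg, ← neg_mul] at h1
      rw [cliffordSign_z₀, ← neg_eq_iff_eq_neg]
      exact right_eq_mul.1 h1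

end DoubleCoverCocycle

/-! ## Uniqueness of the twist -/

section Uniqueness

variable {n : ℕ}

theorem conj_mul (σ ρ : Equiv.Perm (Fin n)) (τ : Transposition n) :
    conj (σ * ρ) τ = conj σ (conj ρ τ) :=
  Subtype.ext (by simp only [conj, mul_inv_rev, mul_assoc])

theorem conj_one (τ : Transposition n) : conj 1 τ = τ :=
  Subtype.ext (by simp [conj])

theorem conj_eq_iff (σ : Equiv.Perm (Fin n)) (τ υ : Transposition n) :
    conj σ τ = υ ↔ σ * τ.1 = υ.1 * σ := by
  rw [Subtype.ext_iff, conj, mul_inv_eq_iff_eq_mul]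

/-- Functions `D(σ, τ)` with `D(ρσ, τ) = D(ρ, στσ⁻¹) D(σ, τ)`, with values in `C₂`. -/
def IsYD (D : Equiv.Perm (Fin n) → Transposition n → C₂) : Prop :=
  ∀ ρ σ τ, D (ρ * σ) τ = D ρ (conj σ τ) * D σ τ

theorem IsYD.mul {D E : Equiv.Perm (Fin n) → Transposition n → C₂} (hD : IsYD D) (hE : IsYD E) :
    IsYD fun σ τ => D σ τ * E σ τ := fun ρ σ τ => by
  dsimp only
  rw [hD, hE, mul_mul_mul_comm]

/-- Conjugation in the central extension belonging to a cocycle. -/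
theorem isYD_of_cocycle (ν : TwoCocycle (Equiv.Perm (Fin n)) C₂) :
    IsYD fun σ τ => ν σ τ.1 * (ν (conj σ τ).1 σ)⁻¹ := by
  intro ρ σ τ
  have h1 := ν.cocycle ρ σ τ.1
  have h2 := ν.cocycle ρ (conj σ τ).1 σ
  have h3 := ν.cocycle (conj ρ (conj σ τ)).1 ρ σ
  have e1 : (conj σ τ).1 * σ = σ * τ.1 := by simp [conj]
  have e2 : (conj ρ (conj σ τ)).1 * ρ = ρ * (conj σ τ).1 := by simp [conj]
  rw [e1] at h2
  rw [e2] at h3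
  dsimp only
  rw [conj_mul, ← div_eq_mul_inv, ← div_eq_mul_inv, ← div_eq_mul_inv, div_mul_div_comm,
    div_eq_div_iff_mul_eq_mul]
  -- After multiplication by this factor, the claim is the product of the three cocycle identities
  -- `h1`, `h2` and `h3`, with `h2` read backwards.
  apply mul_left_cancel (a := ν ρ σ * ν (ρ * (conj σ τ).1) σ * ν ρ (σ * τ.1))
  calc _ = (ν ρ σ * ν (ρ * σ) τ.1) * (ν (conj ρ (conj σ τ)).1 ρ * ν (ρ * (conj σ τ).1) σ) *
        (ν ρ (σ * τ.1) * ν (conj σ τ).1 σ) := by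
        simp only [mul_comm, mul_left_comm, mul_assoc]
    _ = (ν ρ (σ * τ.1) * ν σ τ.1) * (ν (conj ρ (conj σ τ)).1 (ρ * σ) * ν ρ σ) *
        (ν ρ (conj σ τ).1 * ν (ρ * (conj σ τ).1) σ) := by rw [h1, h2, h3]
    _ = _ := by simp only [mul_comm, mul_left_comm, mul_assoc]

open Classical in
/-- The function `q_z / q_1`. -/
def twistSignFull (σ : Equiv.Perm (Fin n)) (τ : Transposition n) : C₂ :=
  (if Equiv.Perm.sign σ = 1 then 1 else z₀) * (if Inverts σ τ then z₀ else 1)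

/-- Both factors are cocycles: the sign is a homomorphism, and inversions add modulo `2` by
`inverts_mul`. The sign factor is what makes the value on transpositions `1` for an inversion and
`z` otherwise. -/
theorem isYD_twistSignFull : IsYD (twistSignFull (n := n)) := by
  intro ρ σ τ
  have hz : z₀ * z₀ = 1 := C₂.mul_self z₀
  unfold twistSignFull
  have hi := inverts_mul ρ σ τ
  simp only [Equiv.Perm.sign_mul]
  rcases Int.units_eq_one_or (Equiv.Perm.sign ρ) with h1 | h1 <;>
  rcases Int.units_eq_one_or (Equiv.Perm.sign σ) with h2 | h2 <;>
  by_cases h3 : Inverts ρ (conj σ τ) <;> by_cases h4 : Inverts σ τ <;>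
  simp [h1, h2, h3, h4, hz, hi]

theorem twistSignFull_eq (τ υ : Transposition n) : twistSignFull τ.1 υ = twistSign τ υ := by
  have hs : Equiv.Perm.sign τ.1 = -1 := τ.2.sign_eq
  unfold twistSignFull twistSign
  rw [hs, if_neg (by decide)]
  split_ifs
  · exact C₂.mul_self z₀
  · exact mul_one z₀

theorem exists_conj_eq (τ υ : Transposition n) : ∃ σ, conj σ τ = υ := by
  obtain ⟨i, j, hij, hτ⟩ := τ.2
  obtain ⟨k, l, hkl, hυ⟩ := υ.2
  obtain ⟨σ, hσ⟩ := isConj_iff.1 (Equiv.Perm.isConj_swap hij hkl)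
  exact ⟨σ, (conj_eq_iff _ _ _).2 (by rw [hτ, hυ, ← hσ, inv_mul_cancel_right])⟩

/-- A function `D` which is trivial on the stabiliser of one transposition is a coboundary. -/
theorem IsYD.exists_coboundary {D : Equiv.Perm (Fin n) → Transposition n → C₂} (hD : IsYD D)
    (τ₀ : Transposition n) (h : ∀ σ, conj σ τ₀ = τ₀ → D σ τ₀ = 1) :
    ∃ φ : Transposition n → C₂, ∀ σ τ, D σ τ * φ τ = φ (conj σ τ) := by
  choose g hg using exists_conj_eq τ₀
  -- Triviality on the stabiliser means that `D(σ, τ₀)` depends only on `στ₀σ⁻¹`, so evaluating at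
  -- any `g` that carries `τ₀` to `τ` defines the function.
  refine ⟨fun τ => D (g τ) τ₀, fun σ τ => ?_⟩
  have hstab : conj ((g (conj σ τ))⁻¹ * (σ * g τ)) τ₀ = τ₀ := by
    rw [conj_mul, conj_mul, hg]
    have h1 := conj_mul (g (conj σ τ))⁻¹ (g (conj σ τ)) τ₀
    rw [hg, inv_mul_cancel, conj_one] at h1
    exact h1.symm
  have h1 := hD σ (g τ) τ₀
  have h2 := hD (g (conj σ τ)) ((g (conj σ τ))⁻¹ * (σ * g τ)) τ₀
  rw [hg] at h1
  rw [mul_inv_cancel_left, hstab, h _ hstab, mul_one] at h2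
  rw [← h1, h2]

/-- The stabiliser of `(0 1)` is generated by `(0 1)` and the simple transpositions that are
disjoint from it. -/
theorem eq_one_of_conj_eq {D : Equiv.Perm (Fin n) → Transposition n → C₂} (hD : IsYD D)
    (h01 : 0 + 1 < n) (h0 : D (simple 0 h01) (simpleX 0 h01) = 1)
    (hk : ∀ k (hk : k + 1 < n), 2 ≤ k → D (simple k hk) (simpleX 0 h01) = 1)
    (σ : Equiv.Perm (Fin n)) (hσ : conj σ (simpleX 0 h01) = simpleX 0 h01) :
    D σ (simpleX 0 h01) = 1 := by
  have hone : D 1 (simpleX 0 h01) = 1 := by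
    have h := hD 1 1 (simpleX 0 h01)
    rw [mul_one, conj_one] at h
    exact right_eq_mul.1 h
  have hmul {ρ σ : Equiv.Perm (Fin n)} (hσ : conj σ (simpleX 0 h01) = simpleX 0 h01)
      (h1 : D ρ (simpleX 0 h01) = 1) (h2 : D σ (simpleX 0 h01) = 1) :
      D (ρ * σ) (simpleX 0 h01) = 1 := by
    rw [hD, hσ, h1, h2, one_mul]
  have hfix {σ : Equiv.Perm (Fin n)} (h1 : σ ⟨0, Nat.lt_of_succ_lt h01⟩ = ⟨0, Nat.lt_of_succ_lt h01⟩)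
      (h2 : σ ⟨0 + 1, h01⟩ = ⟨0 + 1, h01⟩) : conj σ (simpleX 0 h01) = simpleX 0 h01 := by
    refine Subtype.ext ?_
    change σ * Equiv.swap _ _ * σ⁻¹ = Equiv.swap _ _
    rw [← Equiv.swap_apply_apply, h1, h2]
  have hswapfix {i j : Fin n} (hi : 2 ≤ i.1) (hj : 2 ≤ j.1) :
      conj (Equiv.swap i j) (simpleX 0 h01) = simpleX 0 h01 := by
    apply hfix <;> refine Equiv.swap_apply_of_ne_of_ne ?_ ?_ <;> rw [Ne, Fin.ext_iff] <;>
    dsimp only <;> omega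
  -- Transpositions of points `≥ 2` are reached from simple ones by repeated conjugation, with `d +
  -- 1` the distance between the two points.
  have hswap (d : ℕ) : ∀ i : ℕ, 2 ≤ i → ∀ hi : i + d + 1 < n,
      D (Equiv.swap ⟨i, by omega⟩ ⟨i + d + 1, hi⟩) (simpleX 0 h01) = 1 := by
    induction d with
    | zero => exact fun i h2 hi => hk i hi h2
    | succ d ih =>
      intro i h2 hi
      have hs : Equiv.swap (⟨i, by omega⟩ : Fin n) ⟨i + (d + 1) + 1, hi⟩ =
          simple (i + d + 1) hi * (Equiv.swap ⟨i, by omega⟩ ⟨i + d + 1, by omega⟩ *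
            simple (i + d + 1) hi) := by
        have h := Equiv.swap_apply_apply (simple (i + d + 1) hi) ⟨i, by omega⟩
          ⟨i + d + 1, by omega⟩
        rw [simple_inv, mul_assoc] at h
        rw [← h]
        congr 1
        · rw [Fin.ext_iff, simple_val, if_neg (by dsimp only; omega),
            if_neg (by dsimp only; omega)]
        · rw [Fin.ext_iff, simple_val, if_pos rfl]
          rfl
      have hsf : conj (simple (i + d + 1) hi) (simpleX 0 h01) = simpleX 0 h01 :=
        hswapfix (by dsimp only; omega) (by dsimp only; omega)
      have hs' := hk (i + d + 1) hi (by omega)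
      rw [hs]
      refine hmul ?_ hs' (hmul hsf (ih i h2 (by omega)) hs')
      rw [conj_mul, hsf]
      exact hswapfix (by dsimp only; omega) (by dsimp only; omega)
  have hswap' {i j : Fin n} (hij : i < j) (hi : 2 ≤ i.1) :
      D (Equiv.swap i j) (simpleX 0 h01) = 1 := by
    have h := hswap (j.1 - i.1 - 1) i.1 hi (by have := j.2; have := Fin.lt_def.1 hij; omega)
    have hj : (⟨i.1 + (j.1 - i.1 - 1) + 1, by have := j.2; have := Fin.lt_def.1 hij; omega⟩ : Fin n)
        = j := Fin.ext (by have := Fin.lt_def.1 hij; dsimp only; omega)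
    rwa [hj] at h
  -- Permutations fixing `0` and `1`: multiplying by the transposition of `x` and `σ x`, both `≥ 2`,
  -- shrinks the support.
  have hpoint (m : ℕ) : ∀ σ : Equiv.Perm (Fin n), σ.support.card ≤ m →
      σ ⟨0, Nat.lt_of_succ_lt h01⟩ = ⟨0, Nat.lt_of_succ_lt h01⟩ →
      σ ⟨0 + 1, h01⟩ = ⟨0 + 1, h01⟩ → D σ (simpleX 0 h01) = 1 := by
    induction m with
    | zero =>
      intro σ hm _ _
      rw [Nat.le_zero, Finset.card_eq_zero, Equiv.Perm.support_eq_empty_iff] at hm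
      rw [hm, hone]
    | succ m ih =>
      intro σ hm h1 h2
      by_cases hσ : σ = 1
      · rw [hσ, hone]
      obtain ⟨x, hx⟩ : ∃ x, σ x ≠ x := by
        by_contra! h
        exact hσ (Equiv.ext h)
      have hge {y : Fin n} (hy : σ y ≠ y) : 2 ≤ y.1 := by
        by_contra! hlt
        have : y = ⟨0, Nat.lt_of_succ_lt h01⟩ ∨ y = ⟨0 + 1, h01⟩ := by
          rw [Fin.ext_iff, Fin.ext_iff]; dsimp only; omega
        rcases this with rfl | rfl
        · exact hy h1
        · exact hy h2
      have hx2 := hge hx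
      have hσx2 : 2 ≤ (σ x).1 := hge fun h => hx (σ.injective h)
      have hcard := Equiv.Perm.card_support_swap_mul hx
      have hs : D (Equiv.swap x (σ x)) (simpleX 0 h01) = 1 := by
        rcases lt_or_gt_of_ne hx with h | h
        · rw [Equiv.swap_comm]; exact hswap' h hσx2
        · exact hswap' h hx2
      have hs0 (y : Fin n) (hy : y.1 < 2) : Equiv.swap x (σ x) y = y := by
        refine Equiv.swap_apply_of_ne_of_ne ?_ ?_ <;> rw [Ne, Fin.ext_iff] <;> omega
      have h1' : (Equiv.swap x (σ x) * σ) ⟨0, Nat.lt_of_succ_lt h01⟩ =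
          ⟨0, Nat.lt_of_succ_lt h01⟩ := by
        rw [Equiv.Perm.mul_apply, h1, hs0 _ (by dsimp only; omega)]
      have h2' : (Equiv.swap x (σ x) * σ) ⟨0 + 1, h01⟩ = ⟨0 + 1, h01⟩ := by
        rw [Equiv.Perm.mul_apply, h2, hs0 _ (by dsimp only; omega)]
      have h := hmul (hfix h1' h2') hs (ih _ (by omega) h1' h2')
      rwa [← mul_assoc, Equiv.swap_mul_self, one_mul] at h
  have hsw : Equiv.swap (σ ⟨0, Nat.lt_of_succ_lt h01⟩) (σ ⟨0 + 1, h01⟩) =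
      Equiv.swap ⟨0, Nat.lt_of_succ_lt h01⟩ ⟨0 + 1, h01⟩ := by
    rw [Equiv.swap_apply_apply]
    exact congrArg Subtype.val hσ
  have hne : σ ⟨0, Nat.lt_of_succ_lt h01⟩ ≠ σ ⟨0 + 1, h01⟩ := fun h => by
    have := Fin.ext_iff.1 (σ.injective h)
    dsimp only at this
    omega
  -- An element of the stabiliser fixes `0` and `1` or exchanges them; the second case reduces to
  -- the first through `(0 1)`.
  rcases lt_or_gt_of_ne hne with h | h
  · obtain ⟨h1, h2⟩ := swap_eq_of_lt h (Fin.mk_lt_mk.2 (by omega)) hsw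
    exact hpoint _ σ le_rfl h1 h2
  · rw [Equiv.swap_comm] at hsw
    obtain ⟨h1, h2⟩ := swap_eq_of_lt h (Fin.mk_lt_mk.2 (by omega)) hsw
    have h1' : (simple 0 h01 * σ) ⟨0, Nat.lt_of_succ_lt h01⟩ = ⟨0, Nat.lt_of_succ_lt h01⟩ := by
      rw [Equiv.Perm.mul_apply, h2]
      exact Equiv.swap_apply_right _ _
    have h2' : (simple 0 h01 * σ) ⟨0 + 1, h01⟩ = ⟨0 + 1, h01⟩ := by
      rw [Equiv.Perm.mul_apply, h1]
      exact Equiv.swap_apply_left _ _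
    have h3 := hmul (hfix h1' h2') h0 (hpoint _ _ le_rfl h1' h2')
    rwa [← mul_assoc, simple_mul_self, one_mul] at h3

/-- In the application `h = φ(τυ)` and `g = φ(τ)` occur in both coboundaries and cancel, and `s² =
1`. Of the coboundary only `φ(υ)` and `φ(τυτ⁻¹)` survive, which is why it can be absorbed in a
rescaling. -/
theorem rescaling_identity (s a b d f g h k : C₂) : a * (f * k) =
    s * (b * (d * (a * (f * h⁻¹ * g) * (b * (g * h⁻¹ * d))⁻¹ * s * k))) := by
  apply Multiplicative.toAdd.injective
  simp only [toAdd_mul, toAdd_inv]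
  linear_combination -CharTwo.add_self_eq_zero (Multiplicative.toAdd s)

/-- The commutation of transpositions with respect to a representative of `[1, z]`. -/
theorem InClass.exists_rescaling {μ : TwoCocycle (Equiv.Perm (Fin n)) C₂} (hμ : InClass 1 z₀ μ) :
    ∃ c : Transposition n → C₂, ∀ τ υ : Transposition n,
      μ τ.1 υ.1 * c υ = twistSign τ υ * (μ (conj τ.1 υ).1 τ.1 * c (conj τ.1 υ)) := by
  obtain ⟨ν, ⟨φ, -, hφ⟩, hself, hcomm⟩ := hμ
  by_cases h01 : 0 + 1 < n
  -- The product measures the discrepancy between conjugation for `ν` and `q_z / q_1`. At `s_0` both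
  -- factors are `1`; at `s_k` with `k ≥ 2` both are `z`, and `z² = 1`.
  · have hD := (isYD_of_cocycle ν).mul isYD_twistSignFull
    obtain ⟨ψ, hψ⟩ := hD.exists_coboundary (simpleX 0 h01) (eq_one_of_conj_eq hD h01 (by
      have h1 : conj (simple 0 h01) (simpleX 0 h01) = simpleX 0 h01 :=
        (conj_eq_iff _ _ _).2 rfl
      have h2 : twistSignFull (simpleX 0 h01).1 (simpleX 0 h01) = 1 := by
        rw [twistSignFull_eq]
        refine if_pos ((inverts_simpleX_iff _ _).2 ?_)
        rw [Fin.lt_def]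
        change ((simple 0 h01 _ : Fin n) : ℕ) < ((simple 0 h01 _ : Fin n) : ℕ)
        rw [simple_val, simple_val]
        simp
      rw [h1]
      exact (congrArg₂ (· * ·) (mul_inv_cancel _) h2).trans (mul_one 1)) (fun k hk hk2 => by
      have h1 := conj_simpleX_of_lt h01 hk (by omega)
      have h2 : twistSignFull (simpleX k hk).1 (simpleX 0 h01) = z₀ := by
        rw [twistSignFull_eq]
        exact if_neg (inverts_simpleX_simpleX h01 hk (by omega)).1
      obtain ⟨h3, h4⟩ := hcomm 0 k h01 hk (by omega)
      rw [h1]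
      change ν (simple k hk) (simple 0 h01) * (ν (simple 0 h01) (simple k hk))⁻¹ *
        twistSignFull (simpleX k hk).1 (simpleX 0 h01) = 1
      rw [h2, h3, h4, inv_one, mul_one]
      exact C₂.mul_self z₀))
    -- The factor `φ` accounts for the passage from `μ` to the normalised cocycle `ν`, and `ψ` for
    -- the discrepancy of `ν`.
    refine ⟨fun τ => φ τ.1 * ψ τ, fun τ υ => ?_⟩
    have h1 := hψ τ.1 υ
    have h2 := hφ τ.1 υ.1
    have h3 := hφ (conj τ.1 υ).1 τ.1
    have h4 : (conj τ.1 υ).1 * τ.1 = τ.1 * υ.1 := by simp [conj]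
    rw [h4] at h3
    rw [twistSignFull_eq, h2, h3] at h1
    dsimp only
    rw [← h1]
    exact rescaling_identity (twistSign τ υ) (μ τ.1 υ.1) (μ (conj τ.1 υ).1 τ.1)
      (φ (conj τ.1 υ).1) (φ υ.1) (φ τ.1) (φ (τ.1 * υ.1)) (ψ υ)
  -- For `n ≤ 1` there are no transpositions.
  · refine ⟨fun _ => 1, fun τ => ?_⟩
    obtain ⟨i, j, hij, -⟩ := exists_lt_swap τ
    have := Fin.lt_def.1 hij
    have := j.2
    omega

end Uniqueness

/-! ## The twist relations between `q_1`, `q_{-1}` and `q_z` -/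

section MainTheorem

variable {n : ℕ}

theorem qCocycle_of_inverts {R : Type*} [CommRing R] (u : Rˣ) (hu : u * u = 1)
    {τ υ : Transposition n} (h : Inverts τ.1 υ) : qCocycle n u hu τ.1 υ = -1 := by
  classical
  obtain ⟨i, j, hij, hυ⟩ := exists_lt_swap υ
  rw [qCocycle_apply n u hu τ υ hij hυ, if_neg ((inverts_iff _ _ hij hυ).1 h).not_gt]

theorem qCocycle_of_not_inverts {R : Type*} [CommRing R] (u : Rˣ) (hu : u * u = 1)
    {τ υ : Transposition n} (h : ¬ Inverts τ.1 υ) : qCocycle n u hu τ.1 υ = u := by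
  classical
  obtain ⟨i, j, hij, hυ⟩ := exists_lt_swap υ
  rw [inverts_iff _ _ hij hυ, not_lt] at h
  rw [qCocycle_apply n u hu τ υ hij hυ,
    if_pos (lt_of_le_of_ne h fun h' => hij.ne (τ.1.injective h'))]

theorem evalNegOne_z₀ : evalNegOne z₀ = -1 := by
  change (if z₀ = 1 then (1 : ℂˣ) else -1) = -1
  exact if_neg (by decide)

/-- The constants `±1` in `ℂC₂`, obtained by evaluation at `z = -1`. -/
def constSign : C₂ →* ℂC₂ˣ := (Units.map (algebraMap ℂ ℂC₂ : ℂ →* ℂC₂)).comp evalNegOne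

theorem constSign_z₀ : constSign z₀ = -1 := by
  rw [constSign, MonoidHom.comp_apply, evalNegOne_z₀]
  ext1
  simp

/-- On transpositions `q_z` is `q_1` times the image of `twistSign`: both are `-1` on inversions,
and otherwise they are `z` and `1`. -/
theorem twistRel_q₁ {μ : TwoCocycle (Equiv.Perm (Fin n)) C₂} {c : Transposition n → C₂}
    (h : ∀ τ υ : Transposition n,
      μ τ.1 υ.1 * c υ = twistSign τ υ * (μ (conj τ.1 υ).1 τ.1 * c (conj τ.1 υ))) :
    TwistRel ((q₁ n).map (algebraMap ℂ ℂC₂)) (qz n) (μ.map toUnitsRing)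
      fun τ => toUnitsRing (c τ) := by
  intro τ υ
  change Units.map _ (q₁ n τ.1 υ) * (toUnitsRing (μ τ.1 υ.1) * toUnitsRing (c υ)) =
    qz n τ.1 υ * (toUnitsRing (μ (conj τ.1 υ).1 τ.1) * toUnitsRing (c (conj τ.1 υ)))
  rw [← map_mul toUnitsRing, ← map_mul toUnitsRing, h, map_mul toUnitsRing, ← mul_assoc]
  congr 1
  by_cases hi : Inverts τ.1 υ
  · rw [qCocycle_of_inverts _ _ hi, qCocycle_of_inverts _ _ hi, twistSign, if_pos hi, map_one,
      mul_one]
    ext1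
    simp
  · rw [qCocycle_of_not_inverts _ _ hi, qCocycle_of_not_inverts _ _ hi, twistSign, if_neg hi,
      map_one, one_mul]
    rfl

/-- On non-inversions `q_z / q_{-1} = -z` is the image of `z₀` in `ℂC₂` times its value at `z = -1`.
This is why both `μ` and `c` are multiplied by their evaluations. -/
theorem twistRel_qNeg {μ : TwoCocycle (Equiv.Perm (Fin n)) C₂} {c : Transposition n → C₂}
    (h : ∀ τ υ : Transposition n,
      μ τ.1 υ.1 * c υ = twistSign τ υ * (μ (conj τ.1 υ).1 τ.1 * c (conj τ.1 υ))) :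
    TwistRel ((qNeg n).map (algebraMap ℂ ℂC₂)) (qz n) (mulEval μ)
      fun τ => toUnitsRing (c τ) * constSign (c τ) := by
  intro τ υ
  change Units.map _ (qNeg n τ.1 υ) * (toUnitsRing (μ τ.1 υ.1) * constSign (μ τ.1 υ.1) *
      (toUnitsRing (c υ) * constSign (c υ))) =
    qz n τ.1 υ * (toUnitsRing (μ (conj τ.1 υ).1 τ.1) * constSign (μ (conj τ.1 υ).1 τ.1) *
      (toUnitsRing (c (conj τ.1 υ)) * constSign (c (conj τ.1 υ))))
  rw [mul_mul_mul_comm (toUnitsRing (μ τ.1 υ.1)),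
    mul_mul_mul_comm (toUnitsRing (μ (conj τ.1 υ).1 τ.1)), ← map_mul toUnitsRing,
    ← map_mul constSign, ← map_mul toUnitsRing, ← map_mul constSign, h, map_mul toUnitsRing,
    map_mul constSign, mul_mul_mul_comm (toUnitsRing (twistSign τ υ)), ← mul_assoc]
  congr 1
  have hneg : Units.map (algebraMap ℂ ℂC₂ : ℂ →* ℂC₂) (-1) = -1 := by
    ext1
    simp
  by_cases hi : Inverts τ.1 υ
  · rw [qCocycle_of_inverts _ _ hi, qCocycle_of_inverts _ _ hi, twistSign, if_pos hi, map_one,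
      map_one, mul_one, mul_one]
    exact hneg
  · rw [qCocycle_of_not_inverts _ _ hi, qCocycle_of_not_inverts _ _ hi, twistSign, if_neg hi,
      constSign_z₀, mul_neg_one, mul_neg]
    refine (congrArg (fun u => -(u * toUnitsRing z₀)) hneg).trans ?_
    rw [neg_one_mul, neg_neg]
    rfl

theorem eval_qz (ζ : ℂˣ) (hζ : ζ * ζ = 1) (hζ' : (ζ : ℂ) * ζ = 1) (τ υ : Transposition n) :
    eval ζ hζ' (qz n τ.1 υ) = (qCocycle n ζ hζ τ.1 υ : ℂ) := by
  by_cases hi : Inverts τ.1 υ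
  · rw [qCocycle_of_inverts _ _ hi, qCocycle_of_inverts _ _ hi]
    simp
  · rw [qCocycle_of_not_inverts _ _ hi, qCocycle_of_not_inverts _ _ hi, eval_z]

theorem eval_qz_one (τ υ : Transposition n) :
    eval 1 (one_mul 1) (qz n τ.1 υ) = (q₁ n τ.1 υ : ℂ) :=
  eval_qz 1 (one_mul 1) (one_mul 1) τ υ

theorem neg_one_mul_self : (-1 : ℂ) * -1 = 1 := by norm_num

theorem eval_qz_neg_one (τ υ : Transposition n) :
    eval (-1) neg_one_mul_self (qz n τ.1 υ) = (qNeg n τ.1 υ : ℂ) :=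
  eval_qz (-1) (by norm_num) neg_one_mul_self τ υ

/-- Chinese remainder theorem: the two evaluations have as kernels the annihilators of complementary
idempotents, and `idem 1 • a + idem (-1) • b` realises any prescribed pair of values. -/
theorem exists_prod_algEquiv {Φ₁ : BX (qz n) →ₐ[ℂ] BX (q₁ n)} {Φ₂ : BX (qz n) →ₐ[ℂ] BX (qNeg n)}
    (he₁ : ∀ τ, Φ₁ (e (qz n) τ) = e (q₁ n) τ)
    (hr₁ : ∀ (r : ℂC₂) b, Φ₁ (r • b) = eval 1 (one_mul 1) r • Φ₁ b)
    (he₂ : ∀ τ, Φ₂ (e (qz n) τ) = e (qNeg n) τ)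
    (hr₂ : ∀ (r : ℂC₂) b, Φ₂ (r • b) = eval (-1) neg_one_mul_self r • Φ₂ b) :
    ∃ Φ : BX (qz n) ≃ₐ[ℂ] BX (q₁ n) × BX (qNeg n),
      (∀ τ, Φ (e (qz n) τ) = (e (q₁ n) τ, e (qNeg n) τ)) ∧
      Φ (algebraMap ℂC₂ (BX (qz n)) (z : ℂC₂)) = (1, -1) ∧
      (∀ b, b ∈ idealPart n 1 ↔ (Φ b).2 = 0) ∧
      ∀ b, b ∈ idealPart n (-1) ↔ (Φ b).1 = 0 := by
  have hz₁ (b : BX (qz n)) : Φ₁ b = 0 ↔ idem 1 • b = 0 := evaluation_eq_zero_iff he₁ hr₁ eval_qz_one b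
  have hz₂ (b : BX (qz n)) : Φ₂ b = 0 ↔ idem (-1) • b = 0 :=
    evaluation_eq_zero_iff he₂ hr₂ eval_qz_neg_one b
  have hinj : Function.Injective (Φ₁.prod Φ₂) := by
    rw [injective_iff_map_eq_zero]
    intro b hb
    obtain ⟨h1, h2⟩ := Prod.ext_iff.1 hb
    rw [← idem_smul_add 1 b, (hz₁ b).1 h1, (hz₂ b).1 h2, add_zero]
  have hsurj : Function.Surjective (Φ₁.prod Φ₂) := by
    rintro ⟨x, y⟩
    obtain ⟨a, rfl⟩ := evaluation_surjective he₁ x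
    obtain ⟨b, rfl⟩ := evaluation_surjective he₂ y
    refine ⟨idem 1 • a + idem (-1) • b, Prod.ext ?_ ?_⟩
    · change Φ₁ _ = _
      rw [map_add, hr₁, hr₁, eval_idem_self, eval_idem_neg, one_smul, zero_smul, add_zero]
    · change Φ₂ _ = _
      have h := eval_idem_neg (-1) neg_one_mul_self
      rw [neg_neg] at h
      rw [map_add, hr₂, hr₂, eval_idem_self, h, one_smul, zero_smul, zero_add]
  refine ⟨AlgEquiv.ofBijective (Φ₁.prod Φ₂) ⟨hinj, hsurj⟩, fun τ => Prod.ext (he₁ τ) (he₂ τ), ?_,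
    fun b => (mem_idealPart_iff (one_mul 1) b).trans (hz₂ b).symm, fun b => ?_⟩
  · rw [Algebra.algebraMap_eq_smul_one]
    refine Prod.ext ?_ ?_
    · change Φ₁ _ = 1
      rw [hr₁, eval_z, map_one, one_smul]
    · change Φ₂ _ = -1
      rw [hr₂, eval_z, map_one]
      exact neg_one_smul ℂ (1 : BX (qNeg n))
  · have h := mem_idealPart_iff neg_one_mul_self b
    rw [neg_neg] at h
    exact h.trans (hz₁ b).symm

end MainTheorem

end SuperNichols

end

/-! ### The main theorem -/

open SuperNichols in
theorem mainTheorem6 (n : ℕ) :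
    ∃ (_ : GradedAlgebra (degree (q₁ n))) (_ : GradedAlgebra (degree (qNeg n)))
      (_ : GradedAlgebra (degree (qz n))),
      -- Cocycle extensions: for every representative of the class `[1, z]`, and with
      -- `e_τ ↦ 1 ⊗ e_τ` for a suitable representative.
      (∀ μ : TwoCocycle (Equiv.Perm (Fin n)) C₂, InClass 1 z₀ μ →
        (∃ (F : BX (qz n) ≃ₐ[ℂC₂] CocycleExtension (degree (q₁ n)) (μ.map toUnitsRing))
          (c : Transposition n → ℂC₂ˣ), IsExtensionIso F c) ∧
        (∃ (F : BX (qz n) ≃ₐ[ℂC₂] CocycleExtension (degree (qNeg n)) (mulEval μ))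
          (c : Transposition n → ℂC₂ˣ), IsExtensionIso F c)) ∧
      (∃ μ : TwoCocycle (Equiv.Perm (Fin n)) C₂, InClass 1 z₀ μ ∧
        (∃ F : BX (qz n) ≃ₐ[ℂC₂] CocycleExtension (degree (q₁ n)) (μ.map toUnitsRing),
          IsExtensionIso F 1) ∧
        (∃ F : BX (qz n) ≃ₐ[ℂC₂] CocycleExtension (degree (qNeg n)) (mulEval μ),
          IsExtensionIso F 1)) ∧
      -- Flat deformation: freeness and the two specialisations.
      Module.Free ℂC₂ (BX (qz n)) ∧
      (∃ S : Specialisation (BX (qz n)) (z : ℂC₂) 1 ≃ₐ[ℂ] BX (q₁ n),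
        ∀ τ, S (RingQuot.mkAlgHom ℂ _ (e (qz n) τ)) = e (q₁ n) τ) ∧
      (∃ S : Specialisation (BX (qz n)) (z : ℂC₂) (-1) ≃ₐ[ℂ] BX (qNeg n),
        ∀ τ, S (RingQuot.mkAlgHom ℂ _ (e (qz n) τ)) = e (qNeg n) τ) ∧
      -- Decomposition into two-sided ideals.
      IsCompl (idealPart n 1) (idealPart n (-1)) ∧
      ∃ Φ : BX (qz n) ≃ₐ[ℂ] BX (q₁ n) × BX (qNeg n),
        (∀ τ, Φ (e (qz n) τ) = (e (q₁ n) τ, e (qNeg n) τ)) ∧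
        Φ (algebraMap ℂC₂ (BX (qz n)) (z : ℂC₂)) = (1, -1) ∧
        (∀ b, b ∈ idealPart n 1 ↔ (Φ b).2 = 0) ∧
        ∀ b, b ∈ idealPart n (-1) ↔ (Φ b).1 = 0 := by
  obtain ⟨Φ₁, he₁, hr₁⟩ := exists_evaluation 1 (one_mul 1) eval_qz_one
  obtain ⟨Φ₂, he₂, hr₂⟩ := exists_evaluation (-1) neg_one_mul_self eval_qz_neg_one
  obtain ⟨μ₀, hμ₀, hμ₀'⟩ := exists_inClass (n := n)
  -- The factors `1` are the trivial rescaling `c = 1`, which gives `e_τ ↦ 1 ⊗ e_τ` for this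
  -- representative.
  have hμ₀'' : ∀ τ υ : Transposition n, μ₀ τ.1 υ.1 * 1 =
      twistSign τ υ * (μ₀ (conj τ.1 υ).1 τ.1 * 1) := fun τ υ => by
    rw [mul_one, mul_one, hμ₀']
  have hT₁ := twistRel_q₁ (c := fun _ => 1) hμ₀''
  have hT₂ := twistRel_qNeg (c := fun _ => 1) hμ₀''
  simp only [map_one, mul_one] at hT₁ hT₂
  refine ⟨inferInstance, inferInstance, inferInstance, fun μ hμ => ?_,
    ⟨μ₀, hμ₀, exists_isExtensionIso hT₁, exists_isExtensionIso hT₂⟩,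
    free_BX_of_twistRel hT₁, exists_specialisation_algEquiv he₁ hr₁ eval_qz_one,
    exists_specialisation_algEquiv he₂ hr₂ eval_qz_neg_one, isCompl_idealPart (one_mul 1),
    exists_prod_algEquiv he₁ hr₁ he₂ hr₂⟩
  · obtain ⟨c, hc⟩ := hμ.exists_rescaling
    obtain ⟨F, hF⟩ := exists_isExtensionIso (twistRel_q₁ hc)
    obtain ⟨F', hF'⟩ := exists_isExtensionIso (twistRel_qNeg hc)
    exact ⟨⟨F, _, hF⟩, ⟨F', _, hF'⟩⟩
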